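/- A matchstick graph is a finite simple graph drawn in the Euclidean plane so that its vertices are distinct points, every edge is a straight-line segment of length $1$ joining its two endpoints, and edges intersect only at common endpoints (so no vertex lies in the relative interior of an edge, and the relative interiors of distinct edges are disjoint); it need not be connected. Let $G$ be a matchstick graph with $n \ge 1$ vertices and no isolated vertices (that is, no vertices of degree $0$), and for each $i$ let $n_i$ be the number of vertices of $G$ of degree $i$. Then $$4n_1 + 3n_2 + 2n_3 + n_4 > \sqrt{\pi\sqrt{3}\cdot n}.$$ -/

import Mathlib

/-- A matchstick graph with vertex set `V`: a simple graph drawn in the Euclidean plane, with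
distinct vertices at distinct points and each edge `uv` drawn as the straight segment from
`pos u` to `pos v` of length one, such that edges meet only at common endpoints.  The relative
interior of an edge is the open segment between its ends; it contains no vertex and no
interior point of another edge.  Connectedness is not required. -/
structure MatchstickGraph (V : Type*) where
  /-- The underlying abstract graph. -/
  graph : SimpleGraph V
  /-- The points at which the vertices are drawn. -/
  pos : V → EuclideanSpace ℝ (Fin 2)
  /-- Vertices are distinct points. -/
  pos_injective : Function.Injective pos
  /-- Edges have unit length. -/
  unit_length : ∀ u v, graph.Adj u v → dist (pos u) (pos v) = 1
  /-- No vertex lies in the relative interior of an edge. -/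
  vertex_not_mem_edge : ∀ u v w, graph.Adj u v → pos w ∉ openSegment ℝ (pos u) (pos v)
  /-- The relative interiors of two different edges are disjoint. -/
  edges_disjoint : ∀ u v x y, graph.Adj u v → graph.Adj x y → s(u, v) ≠ s(x, y) →
    Disjoint (openSegment ℝ (pos u) (pos v)) (openSegment ℝ (pos x) (pos y))

/-- The number `n_i` of vertices of degree `i`. -/
def MatchstickGraph.numDegree {V : Type*} [Fintype V] (G : MatchstickGraph V)
    [DecidableRel G.graph.Adj] (i : ℕ) : ℕ :=
  (Finset.univ.filter fun v : V => G.graph.degree v = i).card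

/-! Let W be the left-hand side, b the number of darts (oriented edges) bordering the outer region,
and t the number of triangular regions. Three estimates suffice: b ≤ W, n + b ≤ t + W, π√3 · t < b².
They give π√3 · n < b² + π√3 (W - b), which is at most W² when b = W or W + b ≥ 6; `sq_gt_of_bounds`
also excludes the few remaining small values.

The first two estimates come from discharging. A corner of angle θ carries 3θ/π - 1, so a region
with k darts and turning 2πτ has charge 2k - 6τ, and the corners at a vertex of degree d carry 6 - d
in all; this plays the role of Euler's formula. Inner regions can afford to pay each corner its
`cornerShare` (`RegionLabelling.sum_cornerShare_le`), the outer region has b left over after doing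
so, and a vertex of degree d receives at least 6 - d - w(d), where w(d) is its weight in W
(`vertex_charge`). Hence b ≤ W. The second estimate is a direct count in which the triangles are the
only inner regions with k > 2 · charge.

For the third, each triangle has area √3/4 and the inner regions have nonnegative signed area, so
the outer boundary encloses at least t√3/4. The isoperimetric inequality for closed unit-sided
walks, proved by the discrete Fourier transform, bounds that area strictly by b²/(4π).

Regions are not topological faces but labels on darts (`RegionLabelling`), with only the needed
properties: labels persist along boundary walks, inner turning is 2πτ with an integer τ ≤ 1, inner
area is positive, outer turning is nonpositive. A maximal noncrossing straight-line drawing on the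
same vertices is labelled by its triangles; deleting the extra edges one by one merges labels and
keeps these properties. Connectedness is never needed: additional boundary components only lower the
turning. -/

/-! ### Counterclockwise gaps between directions. -/

/-- The counterclockwise gap, in `(0, 2π]`, from direction `x` to direction `y`. -/
noncomputable def ccwGap (x y : ℝ) : ℝ := if x < y then y - x else y - x + 2 * Real.pi

theorem ccwGap_pos {x y : ℝ} (hx : x ∈ Set.Ioc (-Real.pi) Real.pi)
    (hy : y ∈ Set.Ioc (-Real.pi) Real.pi) : 0 < ccwGap x y := by
  unfold ccwGap
  split_ifs <;> linarith [hx.1, hx.2, hy.1, hy.2]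

theorem ccwGap_le (x y : ℝ) (hx : x ∈ Set.Ioc (-Real.pi) Real.pi)
    (hy : y ∈ Set.Ioc (-Real.pi) Real.pi) : ccwGap x y ≤ 2 * Real.pi := by
  unfold ccwGap
  split_ifs <;> linarith [hx.1, hx.2, hy.1, hy.2]

theorem ccwGap_self (x : ℝ) : ccwGap x x = 2 * Real.pi := by simp [ccwGap]

theorem ccwGap_add_of_lt {x y w : ℝ} (hx : x ∈ Set.Ioc (-Real.pi) Real.pi)
    (hy : y ∈ Set.Ioc (-Real.pi) Real.pi) (hw : w ∈ Set.Ioc (-Real.pi) Real.pi)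
    (h : ccwGap x y < ccwGap x w) : ccwGap x w = ccwGap x y + ccwGap y w := by
  unfold ccwGap at *
  split_ifs at * <;> linarith [hx.1, hx.2, hy.1, hy.2, hw.1, hw.2]

theorem ccwGap_right_inj {x y w : ℝ} (hy : y ∈ Set.Ioc (-Real.pi) Real.pi)
    (hw : w ∈ Set.Ioc (-Real.pi) Real.pi) (h : ccwGap x y = ccwGap x w) : y = w := by
  unfold ccwGap at *
  split_ifs at * <;> linarith [hy.1, hy.2, hw.1, hw.2]

theorem ccwGap_left_inj {x y w : ℝ} (hy : y ∈ Set.Ioc (-Real.pi) Real.pi)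
    (hw : w ∈ Set.Ioc (-Real.pi) Real.pi) (h : ccwGap y x = ccwGap w x) : y = w := by
  unfold ccwGap at *
  split_ifs at * <;> linarith [hy.1, hy.2, hw.1, hw.2]

/-! ### Cyclic order and corner angles of finitely many directions at a point. -/

section Star

variable {V : Type*}

/-- The element of `S` following direction `α a` counterclockwise (`a` itself if alone). -/
noncomputable def nextDir (α : V → ℝ) (S : Finset V) (a : V) : V :=
  if h : S.Nonempty then (S.exists_min_image (fun b => ccwGap (α a) (α b)) h).choose else a

/-- The angle of the corner of the star `S` starting at `a`. -/
noncomputable def cornerAngle (α : V → ℝ) (S : Finset V) (a : V) : ℝ :=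
  ccwGap (α a) (α (nextDir α S a))

theorem nextDir_mem (α : V → ℝ) {S : Finset V} (hS : S.Nonempty) (a : V) :
    nextDir α S a ∈ S := by
  unfold nextDir
  rw [dif_pos hS]
  exact (S.exists_min_image (fun b => ccwGap (α a) (α b)) hS).choose_spec.1

theorem cornerAngle_le (α : V → ℝ) {S : Finset V} (a : V) {b : V} (hb : b ∈ S) :
    cornerAngle α S a ≤ ccwGap (α a) (α b) := by
  unfold cornerAngle nextDir
  rw [dif_pos ⟨b, hb⟩]
  exact (S.exists_min_image (fun b => ccwGap (α a) (α b)) ⟨b, hb⟩).choose_spec.2 b hb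

variable {α : V → ℝ} (hα : ∀ a, α a ∈ Set.Ioc (-Real.pi) Real.pi) {S : Finset V}
  (hinj : Set.InjOn α S)
include hα

theorem cornerAngle_pos (a : V) : 0 < cornerAngle α S a := ccwGap_pos (hα _) (hα _)

theorem cornerAngle_le_two_pi (a : V) : cornerAngle α S a ≤ 2 * Real.pi :=
  ccwGap_le _ _ (hα _) (hα _)

include hinj

theorem nextDir_eq_of_forall_le {a b : V} (hb : b ∈ S)
    (h : ∀ d ∈ S, ccwGap (α a) (α b) ≤ ccwGap (α a) (α d)) : nextDir α S a = b := by
  have h1 := nextDir_mem α ⟨b, hb⟩ a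
  exact hinj h1 hb (ccwGap_right_inj (hα _) (hα _)
    (le_antisymm (cornerAngle_le α a hb) (h _ h1)))

/-- Of two distinct directions with a common successor, each would have a gap to it no longer than
the other's; equal gaps to the same direction force the starting directions to coincide. -/
theorem nextDir_injOn : Set.InjOn (nextDir α S) S := by
  intro a ha a' ha' h
  by_contra hne
  have hne' : α a ≠ α a' := fun hh => hne (hinj ha ha' hh)
  have hlt : ∀ {p q : V}, p ∈ S → q ∈ S → α p ≠ α q → nextDir α S p = nextDir α S q →
      ccwGap (α q) (α (nextDir α S q)) ≤ ccwGap (α p) (α (nextDir α S p)) := by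
    intro p q hp hq hpq hnn
    rcases (cornerAngle_le α p hq).lt_or_eq with h1 | h1
    · have h2 := ccwGap_add_of_lt (hα _) (hα _) (hα _) h1
      have h4 : cornerAngle α S q ≤ ccwGap (α q) (α p) := cornerAngle_le α q hp
      rw [hnn] at h2
      have h3 := ccwGap_pos (hα p) (hα (nextDir α S q))
      have h5 := ccwGap_pos (hα (nextDir α S q)) (hα q)
      unfold cornerAngle at *
      unfold ccwGap at *
      split_ifs at * <;> rcases lt_or_gt_of_ne hpq with h7 | h7 <;>
        linarith [(hα p).1, (hα p).2, (hα q).1, (hα q).2]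
    · unfold cornerAngle at h1
      have h2 := ccwGap_right_inj (hα _) (hα _) h1
      exfalso
      have h4 : cornerAngle α S q ≤ ccwGap (α q) (α p) := cornerAngle_le α q hp
      unfold cornerAngle at h4
      rw [← hnn, h2, ccwGap_self] at h4
      unfold ccwGap at h4
      split_ifs at h4 <;> rcases lt_or_gt_of_ne hpq with h7 | h7 <;>
        linarith [(hα p).1, (hα p).2, (hα q).1, (hα q).2]
  have h1 := hlt ha ha' hne' h
  have h2 := hlt ha' ha hne'.symm h.symm
  rw [h] at h1 h2
  exact hne' (ccwGap_left_inj (hα _) (hα _) (le_antisymm h2 h1))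

theorem exists_nextDir_eq {w : V} (hw : w ∈ S) : ∃ p ∈ S, nextDir α S p = w := by
  have := Finset.surj_on_of_inj_on_of_card_le (s := S) (t := S) (fun a _ => nextDir α S a)
    (fun a ha => nextDir_mem α ⟨a, ha⟩ a)
    (fun a a' ha ha' h => nextDir_injOn hα hinj ha ha' h) le_rfl w hw
  obtain ⟨a, ha, h⟩ := this
  exact ⟨a, ha, h.symm⟩

theorem nextDir_eq_self_iff {a : V} (ha : a ∈ S) : nextDir α S a = a ↔ S = {a} := by
  constructor
  · intro h
    ext b
    rw [Finset.mem_singleton]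
    constructor
    · intro hb
      have h1 := cornerAngle_le α a hb
      unfold cornerAngle at h1
      rw [h] at h1
      rw [ccwGap_self] at h1
      have h2 := ccwGap_le _ _ (hα a) (hα b)
      exact (hinj ha hb (ccwGap_right_inj (x := α a) (hα _) (hα _) (by
        rw [ccwGap_self]; linarith))).symm
    · rintro rfl; exact ha
  · rintro rfl
    simpa using nextDir_mem α (S := {a}) ⟨a, by simp⟩ a

variable [DecidableEq V]

theorem nextDir_erase_of_ne {w a : V} (ha : a ∈ S) (h : nextDir α S a ≠ w) :
    nextDir α (S.erase w) a = nextDir α S a := by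
  refine nextDir_eq_of_forall_le hα (hinj.mono (by simp)) ?_ ?_
  · exact Finset.mem_erase.2 ⟨h, nextDir_mem α ⟨a, ha⟩ a⟩
  · intro d hd
    exact cornerAngle_le α a (Finset.mem_of_mem_erase hd)

theorem nextDir_erase_of_eq {w a : V} (hw : w ∈ S) (ha : a ∈ S) (haw : a ≠ w)
    (h : nextDir α S a = w) :
    nextDir α (S.erase w) a = nextDir α S w ∧
      cornerAngle α (S.erase w) a = cornerAngle α S a + cornerAngle α S w := by
  have hlt : ∀ d ∈ S.erase w, ccwGap (α a) (α d) = ccwGap (α a) (α w) + ccwGap (α w) (α d) := by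
    intro d hd
    rw [Finset.mem_erase] at hd
    apply ccwGap_add_of_lt (hα _) (hα _) (hα _)
    have h1 := cornerAngle_le α a hd.2
    unfold cornerAngle at h1
    rw [h] at h1
    refine lt_of_le_of_ne h1 fun hh => hd.1 ?_
    exact (hinj hw hd.2 (ccwGap_right_inj (hα _) (hα _) hh)).symm
  have hne : nextDir α S w ≠ w := by
    intro h2
    have := (nextDir_eq_self_iff hα hinj hw).1 h2
    rw [this] at ha
    exact haw (by simpa using ha)
  have hmem : nextDir α S w ∈ S.erase w := Finset.mem_erase.2 ⟨hne, nextDir_mem α ⟨w, hw⟩ w⟩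
  have h3 : nextDir α (S.erase w) a = nextDir α S w := by
    refine nextDir_eq_of_forall_le hα (hinj.mono (by simp)) hmem ?_
    intro d hd
    rw [hlt d hd, hlt _ hmem]
    have := cornerAngle_le α w (Finset.mem_of_mem_erase hd)
    unfold cornerAngle at this
    linarith
  refine ⟨h3, ?_⟩
  unfold cornerAngle
  rw [h3, h, hlt _ hmem]

/-- Erasing a direction conserves the total corner angle in each class of corners, if the
two merged corners belong to the same class. -/
theorem sum_cornerAngle_erase {w p : V} (hw : w ∈ S) (hp : p ∈ S) (hpw : p ≠ w)
    (hnext : nextDir α S p = w) (P : V → Prop) [DecidablePred P] (hP : P p ↔ P w) :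
    ∑ a ∈ (S.erase w).filter P, cornerAngle α (S.erase w) a =
      ∑ a ∈ S.filter P, cornerAngle α S a := by
  obtain ⟨-, h2⟩ := nextDir_erase_of_eq hα hinj hw hp hpw hnext
  have h3 : ∀ a ∈ S.erase w, a ≠ p →
      cornerAngle α (S.erase w) a = cornerAngle α S a := by
    intro a ha hap
    unfold cornerAngle
    rw [nextDir_erase_of_ne hα hinj (Finset.mem_of_mem_erase ha)]
    intro h
    exact hap (nextDir_injOn hα hinj (Finset.mem_of_mem_erase ha) hp (h.trans hnext.symm))
  rw [Finset.sum_filter, Finset.sum_filter, ← Finset.add_sum_erase S _ hw,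
    ← Finset.add_sum_erase (S.erase w) _ (Finset.mem_erase.2 ⟨hpw, hp⟩),
    ← Finset.add_sum_erase (S.erase w) _ (Finset.mem_erase.2 ⟨hpw, hp⟩), h2]
  have h4 : ∑ x ∈ (S.erase w).erase p, (if P x then cornerAngle α (S.erase w) x else 0) =
      ∑ x ∈ (S.erase w).erase p, (if P x then cornerAngle α S x else 0) := by
    apply Finset.sum_congr rfl
    intro x hx
    rw [Finset.mem_erase] at hx
    rw [h3 x hx.2 hx.1]
  rw [h4]
  by_cases h : P w
  · rw [if_pos (hP.2 h), if_pos h, if_pos (hP.2 h)]; ring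
  · rw [if_neg (fun hh => h (hP.1 hh)), if_neg h, if_neg (fun hh => h (hP.1 hh))]; ring

/-- Erasing directions conserves the sum, and a single remaining direction has the full turn as its
only corner. -/
theorem sum_cornerAngle (hS : S.Nonempty) :
    ∑ a ∈ S, cornerAngle α S a = 2 * Real.pi := by
  induction hS using Finset.Nonempty.cons_induction with
  | singleton a =>
    rw [Finset.sum_singleton]
    unfold cornerAngle
    rw [(nextDir_eq_self_iff hα hinj (by simp)).2 rfl, ccwGap_self]
  | cons a s ha hs ih =>
    obtain ⟨p, hp, hnext⟩ := exists_nextDir_eq hα hinj (w := a) (by simp)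
    have hpa : p ≠ a := by
      rintro rfl
      have := (nextDir_eq_self_iff hα hinj hp).1 hnext
      obtain ⟨b, hb⟩ := hs
      have hb' : b ∈ Finset.cons p s ha := by simp [hb]
      rw [this, Finset.mem_singleton] at hb'
      exact ha (hb' ▸ hb)
    have := sum_cornerAngle_erase hα hinj (by simp) hp hpa hnext (fun _ => True) Iff.rfl
    have he : (Finset.cons a s ha).erase a = s := by
      rw [Finset.cons_eq_insert, Finset.erase_insert ha]
    simp only [Finset.filter_true, he] at this
    rw [← this]
    exact ih (hinj.mono (by simp))

end Star

/-! ### Cross products as a test for gaps smaller than π. -/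

/-- The cross product (signed area of the parallelogram) of two plane vectors. -/
def crossProd (u w : ℂ) : ℝ := u.re * w.im - u.im * w.re

theorem crossProd_eq_norm_mul_sin (u w : ℂ) :
    crossProd u w = ‖u‖ * ‖w‖ * Real.sin (w.arg - u.arg) := by
  unfold crossProd
  rw [Real.sin_sub]
  have h1 := Complex.norm_mul_cos_arg u
  have h2 := Complex.norm_mul_sin_arg u
  have h3 := Complex.norm_mul_cos_arg w
  have h4 := Complex.norm_mul_sin_arg w
  rw [← h1, ← h2, ← h3, ← h4]
  ring

theorem sin_ccwGap (x y : ℝ) : Real.sin (ccwGap x y) = Real.sin (y - x) := by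
  unfold ccwGap
  split_ifs
  · rfl
  · rw [Real.sin_add_two_pi]

theorem cos_ccwGap (x y : ℝ) : Real.cos (ccwGap x y) = Real.cos (y - x) := by
  unfold ccwGap
  split_ifs
  · rfl
  · rw [Real.cos_add_two_pi]

theorem coe_ccwGap (x y : ℝ) : ((ccwGap x y : ℝ) : Real.Angle) = (y : Real.Angle) - x := by
  unfold ccwGap
  split_ifs
  · simp
  · simp

theorem ccwGap_lt_pi_iff {u w : ℂ} (hu : u ≠ 0) (hw : w ≠ 0) :
    ccwGap u.arg w.arg < Real.pi ↔ 0 < crossProd u w := by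
  rw [crossProd_eq_norm_mul_sin, ← sin_ccwGap]
  have h1 := ccwGap_pos (Complex.arg_mem_Ioc u) (Complex.arg_mem_Ioc w)
  have h2 := ccwGap_le _ _ (Complex.arg_mem_Ioc u) (Complex.arg_mem_Ioc w)
  have h3 : 0 < ‖u‖ * ‖w‖ := mul_pos (norm_pos_iff.2 hu) (norm_pos_iff.2 hw)
  constructor
  · intro h
    exact mul_pos h3 (Real.sin_pos_of_pos_of_lt_pi h1 h)
  · intro h
    by_contra hcon
    push Not at hcon
    have h4 : Real.sin (ccwGap u.arg w.arg) ≤ 0 := by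
      rw [← Real.sin_sub_two_pi]
      exact Real.sin_nonpos_of_nonpos_of_neg_pi_le (by linarith) (by linarith)
    nlinarith

/-! ### Noncrossing drawings, and triangles in maximal ones. -/

section Drawing

variable {V : Type*}

/-- The direction in which `a` is seen from `v`. -/
noncomputable def dirArg (z : V → ℂ) (v a : V) : ℝ := (z a - z v).arg

theorem dirArg_mem (z : V → ℂ) (v a : V) : dirArg z v a ∈ Set.Ioc (-Real.pi) Real.pi :=
  Complex.arg_mem_Ioc _

/-- A straight-line drawing of a graph whose edges meet only at common ends. -/
structure NonCrossing (z : V → ℂ) (H : SimpleGraph V) : Prop where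
  vertex : ∀ u v w, H.Adj u v → z w ∉ openSegment ℝ (z u) (z v)
  edges : ∀ u v x y, H.Adj u v → H.Adj x y → s(u, v) ≠ s(x, y) →
    Disjoint (openSegment ℝ (z u) (z v)) (openSegment ℝ (z x) (z y))

variable {z : V → ℂ} {H : SimpleGraph V}

theorem NonCrossing.mono {H' : SimpleGraph V} (h : NonCrossing z H) (hle : H' ≤ H) :
    NonCrossing z H' :=
  ⟨fun u v w huv => h.vertex u v w (hle huv),
    fun u v x y huv hxy => h.edges u v x y (hle huv) (hle hxy)⟩

theorem add_smul_mem_openSegment {p q : ℂ} {r : ℝ} (h0 : 0 < r) (h1 : r < 1) :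
    p + r • (q - p) ∈ openSegment ℝ p q := by
  refine ⟨1 - r, r, by linarith, h0, by ring, ?_⟩
  rw [smul_sub, sub_smul, one_smul]; ring

/-- If two neighbours are seen in the same direction, the nearer one lies inside the edge to the
farther one, or both are the same point. -/
theorem NonCrossing.dirArg_inj (h : NonCrossing z H) (hz : Function.Injective z) (v : V) :
    Set.InjOn (dirArg z v) {a | H.Adj v a} := by
  intro a ha b hb hab
  by_contra hne
  simp only [Set.mem_ofPred_eq] at ha hb
  have hane : z a - z v ≠ 0 := sub_ne_zero.2 (fun hh => ha.ne (hz hh).symm)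
  have hbne : z b - z v ≠ 0 := sub_ne_zero.2 (fun hh => hb.ne (hz hh).symm)
  unfold dirArg at hab
  rw [Complex.arg_eq_arg_iff hane hbne] at hab
  set r : ℝ := ‖z b - z v‖ / ‖z a - z v‖ with hr
  have hrpos : 0 < r := div_pos (norm_pos_iff.2 hbne) (norm_pos_iff.2 hane)
  have hab' : r • (z a - z v) = z b - z v := by
    rw [← hab, hr, Complex.real_smul]; push_cast; ring
  rcases lt_trichotomy r 1 with h1 | h1 | h1
  · apply h.vertex v a b ha
    have := add_smul_mem_openSegment (p := z v) (q := z a) hrpos h1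
    rwa [hab', add_sub_cancel] at this
  · rw [h1, one_smul] at hab'
    exact hne (hz (by simpa using hab'))
  · apply h.vertex v b a hb
    have := add_smul_mem_openSegment (p := z v) (q := z b) (inv_pos.2 hrpos) (inv_lt_one_of_one_lt₀ h1)
    rwa [← hab', smul_smul, inv_mul_cancel₀ hrpos.ne', one_smul, add_sub_cancel] at this

theorem NonCrossing.false_of_mem_segment (h : NonCrossing z H) {v a x y : V} (hva : H.Adj v a)
    (hxy : H.Adj x y) (hne : s(x, y) ≠ s(v, a)) {μ : ℝ} (h0 : 0 ≤ μ) (h1 : μ ≤ 1)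
    (hq : z v + μ • (z a - z v) ∈ openSegment ℝ (z x) (z y)) : False := by
  rcases h0.eq_or_lt with rfl | h0
  · rw [zero_smul, add_zero] at hq
    exact h.vertex x y v hxy hq
  rcases h1.eq_or_lt with rfl | h1
  · rw [one_smul, add_sub_cancel] at hq
    exact h.vertex x y a hxy hq
  exact Set.disjoint_left.1 (h.edges x y v a hxy hva hne) hq (add_smul_mem_openSegment h0 h1)

/-- A segment from inside the open quadrant to a point outside the closed one crosses one of the two
bounding half-axes; the sign of `t * s' - s * t'` tells which. In the applications the half-axes are
the two legs of a corner. -/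
theorem exists_exit_quadrant {s t s' t' : ℝ} (hs : 0 < s) (ht : 0 < t) (h : s' < 0 ∨ t' < 0) :
    ∃ r : ℝ, 0 < r ∧ r < 1 ∧ ((s + r * (s' - s) = 0 ∧ 0 ≤ t + r * (t' - t)) ∨
      (t + r * (t' - t) = 0 ∧ 0 ≤ s + r * (s' - s))) := by
  by_cases hc : t * s' ≤ s * t'
  · have hs' : s' < 0 := by
      rcases h with h | h
      · exact h
      · nlinarith
    refine ⟨s / (s - s'), div_pos hs (by linarith), (div_lt_one (by linarith)).2 (by linarith),
      Or.inl ⟨?_, ?_⟩⟩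
    · field_simp [show s - s' ≠ 0 by linarith]; ring
    · have : t + s / (s - s') * (t' - t) = (s * t' - t * s') / (s - s') := by
        field_simp [show s - s' ≠ 0 by linarith]; ring
      rw [this]
      exact div_nonneg (by linarith) (by linarith)
  · push Not at hc
    have ht' : t' < 0 := by
      rcases h with h | h
      · nlinarith
      · exact h
    refine ⟨t / (t - t'), div_pos ht (by linarith), (div_lt_one (by linarith)).2 (by linarith),
      Or.inr ⟨?_, ?_⟩⟩
    · field_simp [show t - t' ≠ 0 by linarith]; ring
    · have : s + t / (t - t') * (s' - s) = (t * s' - s * t') / (t - t') := by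
        field_simp [show t - t' ≠ 0 by linarith]; ring
      rw [this]
      exact div_nonneg (by linarith) (by linarith)

/-- The first barycentric coordinate (unnormalized) with respect to the corner `a v b`. -/
def coordL (v b p : ℂ) : ℝ := crossProd (p - v) (b - v)

/-- The second barycentric coordinate (unnormalized) with respect to the corner `a v b`. -/
def coordR (v a p : ℂ) : ℝ := crossProd (a - v) (p - v)

theorem coordL_combo (v b x y : ℂ) {r r' : ℝ} (h : r + r' = 1) :
    coordL v b (r • x + r' • y) = r * coordL v b x + r' * coordL v b y := by
  obtain rfl : r' = 1 - r := by linarith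
  simp [coordL, crossProd]; ring

theorem coordR_combo (v a x y : ℂ) {r r' : ℝ} (h : r + r' = 1) :
    coordR v a (r • x + r' • y) = r * coordR v a x + r' * coordR v a y := by
  obtain rfl : r' = 1 - r := by linarith
  simp [coordR, crossProd]; ring

/-- Cramer's rule: `coordL` and `coordR`, divided by the determinant of the corner, are the affine
coordinates along its two legs. In these terms the triangle `v a b` is L ≥ 0, R ≥ 0, L + R ≤ D. -/
theorem crossProd_smul_eq_coord (v a b p : ℂ) : crossProd (a - v) (b - v) • (p - v) =
    coordL v b p • (a - v) + coordR v a p • (b - v) := by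
  apply Complex.ext <;> simp [coordL, coordR, crossProd] <;> ring

@[simp] theorem coordL_self (v b : ℂ) : coordL v b v = 0 := by simp [coordL, crossProd]
@[simp] theorem coordL_self_right (v b : ℂ) : coordL v b b = 0 := by
  simp [coordL, crossProd]; ring
@[simp] theorem coordR_self (v b : ℂ) : coordR v b v = 0 := by simp [coordR, crossProd]
@[simp] theorem coordR_self_right (v b : ℂ) : coordR v b b = 0 := by
  simp [coordR, crossProd]; ring

theorem eq_of_coordL_eq_zero {v a b p : ℂ} (hD : 0 < crossProd (a - v) (b - v))
    (h : coordL v b p = 0) :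
    p = v + (coordR v a p / crossProd (a - v) (b - v)) • (b - v) := by
  have := crossProd_smul_eq_coord v a b p
  rw [h, zero_smul, zero_add] at this
  rw [div_eq_inv_mul, mul_smul, ← this, smul_smul, inv_mul_cancel₀ hD.ne', one_smul,
    add_sub_cancel]

theorem eq_of_coordR_eq_zero {v a b p : ℂ} (hD : 0 < crossProd (a - v) (b - v))
    (h : coordR v a p = 0) :
    p = v + (coordL v b p / crossProd (a - v) (b - v)) • (a - v) := by
  have := crossProd_smul_eq_coord v a b p
  rw [h, zero_smul, add_zero] at this
  rw [div_eq_inv_mul, mul_smul, ← this, smul_smul, inv_mul_cancel₀ hD.ne', one_smul,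
    add_sub_cancel]

/-- An edge meeting the interior of an empty corner, at a point where the triangle spanned by
the corner is not yet left, has its nearer end in that triangle. -/
theorem NonCrossing.end_mem_triangle (h : NonCrossing z H) {v a b x y : V}
    (hva : H.Adj v a) (hvb : H.Adj v b)
    (hD : 0 < crossProd (z a - z v) (z b - z v))
    (hE : ∀ d, H.Adj v d → 0 < coordL (z v) (z b) (z d) → 0 < coordR (z v) (z a) (z d) → False)
    (hxy : H.Adj x y) {m : ℂ} (hm : m ∈ openSegment ℝ (z x) (z y))
    (hs : 0 < coordL (z v) (z b) m) (ht : 0 < coordR (z v) (z a) m)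
    (hle : coordL (z v) (z b) m + coordR (z v) (z a) m ≤ crossProd (z a - z v) (z b - z v))
    (hx : coordL (z v) (z b) (z x) + coordR (z v) (z a) (z x) ≤
      coordL (z v) (z b) m + coordR (z v) (z a) m) :
    x ≠ v ∧ 0 ≤ coordL (z v) (z b) (z x) ∧ 0 ≤ coordR (z v) (z a) (z x) := by
  obtain ⟨α, β, hα, hβ, hαβ, rfl⟩ := hm
  refine ⟨?_, ?_⟩
  · rintro rfl
    rw [coordL_combo _ _ _ _ hαβ, coordL_self, mul_zero, zero_add] at hs
    rw [coordR_combo _ _ _ _ hαβ, coordR_self, mul_zero, zero_add] at ht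
    exact hE y hxy (pos_of_mul_pos_right hs hβ.le) (pos_of_mul_pos_right ht hβ.le)
  · by_contra hcon
    have hcon' : coordL (z v) (z b) (z x) < 0 ∨ coordR (z v) (z a) (z x) < 0 := by
      by_contra h2; push Not at h2; exact hcon h2
    set m := α • z x + β • z y with hm
    -- Going from `m` to `x` the sum L + R never exceeds its value at `m`, so the exit point lies on
    -- a leg between `v` and `a` or `b`: the edge `xy` would meet that leg.
    obtain ⟨r, hr0, hr1, hr⟩ := exists_exit_quadrant hs ht hcon'
    have hq : r • z x + (1 - r) • m ∈ openSegment ℝ (z x) (z y) := by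
      refine ⟨r + (1 - r) * α, (1 - r) * β, by nlinarith, mul_pos (by linarith) hβ,
        by linear_combination (1 - r) * hαβ, ?_⟩
      rw [hm, smul_add, smul_smul, smul_smul, add_smul, add_assoc]
    have hnea : s(x, y) ≠ s(v, a) := by
      intro heq
      rw [hm, coordR_combo _ _ _ _ hαβ] at ht
      rcases Sym2.eq_iff.1 heq with ⟨rfl, rfl⟩ | ⟨rfl, rfl⟩ <;> simp at ht
    have hneb : s(x, y) ≠ s(v, b) := by
      intro heq
      rw [hm, coordL_combo _ _ _ _ hαβ] at hs
      rcases Sym2.eq_iff.1 heq with ⟨rfl, rfl⟩ | ⟨rfl, rfl⟩ <;> simp at hs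
    have hqL : coordL (z v) (z b) (r • z x + (1 - r) • m) = coordL (z v) (z b) m +
        r * (coordL (z v) (z b) (z x) - coordL (z v) (z b) m) := by
      rw [coordL_combo _ _ _ _ (by ring)]; ring
    have hqR : coordR (z v) (z a) (r • z x + (1 - r) • m) = coordR (z v) (z a) m +
        r * (coordR (z v) (z a) (z x) - coordR (z v) (z a) m) := by
      rw [coordR_combo _ _ _ _ (by ring)]; ring
    set q := r • z x + (1 - r) • m
    rcases hr with ⟨h1, h2⟩ | ⟨h1, h2⟩
    · rw [← hqL] at h1
      rw [← hqR] at h2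
      have h3 := eq_of_coordL_eq_zero hD h1
      refine h.false_of_mem_segment hvb hxy hneb (div_nonneg h2 hD.le)
        ((div_le_one hD).2 ?_) (h3 ▸ hq)
      nlinarith
    · rw [← hqR] at h1
      rw [← hqL] at h2
      have h3 := eq_of_coordR_eq_zero hD h1
      refine h.false_of_mem_segment hva hxy hnea (div_nonneg h2 hD.le)
        ((div_le_one hD).2 ?_) (h3 ▸ hq)
      nlinarith

/-- In a maximal noncrossing drawing, two vertices whose segment is free are adjacent. -/
theorem NonCrossing.adj_of_maximal (h : NonCrossing z H)
    (hmax : ∀ H', NonCrossing z H' → H ≤ H' → H' ≤ H) {v p : V} (hvp : v ≠ p)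
    (hv : ∀ w, z w ∉ openSegment ℝ (z v) (z p))
    (he : ∀ x y, H.Adj x y → ∀ m ∈ openSegment ℝ (z v) (z p),
      m ∈ openSegment ℝ (z x) (z y) → H.Adj v p) : H.Adj v p := by
  by_contra hcon
  have hnc : NonCrossing z (H ⊔ SimpleGraph.edge v p) := by
    have hdis : ∀ x y, H.Adj x y →
        Disjoint (openSegment ℝ (z v) (z p)) (openSegment ℝ (z x) (z y)) := by
      intro x y hxy
      rw [Set.disjoint_left]
      intro m h1 h2
      exact hcon (he x y hxy m h1 h2)
    constructor
    · intro x y w hxy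
      rw [SimpleGraph.sup_adj, SimpleGraph.edge_adj] at hxy
      rcases hxy with hxy | ⟨⟨rfl, rfl⟩ | ⟨rfl, rfl⟩, -⟩
      · exact h.vertex x y w hxy
      · exact hv w
      · rw [openSegment_symm]; exact hv w
    · intro x y x' y' hxy hxy' hne
      rw [SimpleGraph.sup_adj, SimpleGraph.edge_adj] at hxy hxy'
      rcases hxy with hxy | ⟨⟨rfl, rfl⟩ | ⟨rfl, rfl⟩, -⟩ <;>
      rcases hxy' with hxy' | ⟨⟨rfl, rfl⟩ | ⟨rfl, rfl⟩, -⟩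
      · exact h.edges x y x' y' hxy hxy' hne
      · exact (hdis x y hxy).symm
      · rw [openSegment_symm ℝ (z x')]; exact (hdis x y hxy).symm
      · exact hdis _ _ hxy'
      · exact absurd rfl hne
      · exact absurd Sym2.eq_swap hne
      · rw [openSegment_symm ℝ (z x)]; exact hdis _ _ hxy'
      · exact absurd Sym2.eq_swap hne
      · exact absurd rfl hne
  have := hmax _ hnc le_sup_left
  exact hcon (this (by rw [SimpleGraph.sup_adj, SimpleGraph.edge_adj]; exact Or.inr ⟨Or.inl ⟨rfl, rfl⟩, hvp⟩))

variable [Finite V]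

/-- In a maximal noncrossing drawing, the triangle spanned by an empty corner contains no
further vertex. -/
theorem NonCrossing.triangle_empty (h : NonCrossing z H) (hz : Function.Injective z)
    (hmax : ∀ H', NonCrossing z H' → H ≤ H' → H' ≤ H) {v a b : V}
    (hva : H.Adj v a) (hvb : H.Adj v b)
    (hD : 0 < crossProd (z a - z v) (z b - z v))
    (hE : ∀ d, H.Adj v d → 0 < coordL (z v) (z b) (z d) → 0 < coordR (z v) (z a) (z d) → False)
    (p : V) (hp1 : 0 ≤ coordL (z v) (z b) (z p)) (hp2 : 0 ≤ coordR (z v) (z a) (z p))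
    (hp3 : coordL (z v) (z b) (z p) + coordR (z v) (z a) (z p) ≤
      crossProd (z a - z v) (z b - z v)) : p = v ∨ p = a ∨ p = b := by
  by_contra hcon
  push Not at hcon
  -- Take an intruding vertex with the least L + R. The segment from `v` to it is then free, so by
  -- maximality it is an edge, contradicting the emptiness of the corner.
  obtain ⟨p, ⟨hpv, hpa, hpb, hp1, hp2, hp3⟩, hmin⟩ := Set.exists_min_image
    {p : V | p ≠ v ∧ p ≠ a ∧ p ≠ b ∧ 0 ≤ coordL (z v) (z b) (z p) ∧
      0 ≤ coordR (z v) (z a) (z p) ∧ coordL (z v) (z b) (z p) + coordR (z v) (z a) (z p) ≤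
      crossProd (z a - z v) (z b - z v)}
    (fun p => coordL (z v) (z b) (z p) + coordR (z v) (z a) (z p)) (Set.toFinite _)
    ⟨p, hcon.1, hcon.2.1, hcon.2.2, hp1, hp2, hp3⟩
  have hs : 0 < coordL (z v) (z b) (z p) := by
    refine hp1.lt_of_ne fun h0 => ?_
    have h3 := eq_of_coordL_eq_zero hD h0.symm
    rw [← h0, zero_add] at hp3
    have h4 : coordR (z v) (z a) (z p) ≠ 0 := by
      intro h4
      rw [h4, zero_div, zero_smul, add_zero] at h3
      exact hpv (hz h3)
    have h5 : coordR (z v) (z a) (z p) ≠ crossProd (z a - z v) (z b - z v) := by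
      intro h4
      rw [h4, div_self hD.ne', one_smul, add_sub_cancel] at h3
      exact hpb (hz h3)
    apply h.vertex v b p hvb
    rw [h3]
    exact add_smul_mem_openSegment (div_pos (hp2.lt_of_ne h4.symm) hD)
      ((div_lt_one hD).2 (hp3.lt_of_ne h5))
  have ht : 0 < coordR (z v) (z a) (z p) := by
    refine hp2.lt_of_ne fun h0 => ?_
    have h3 := eq_of_coordR_eq_zero hD h0.symm
    rw [← h0, add_zero] at hp3
    have h4 : coordL (z v) (z b) (z p) ≠ 0 := by
      intro h4
      rw [h4, zero_div, zero_smul, add_zero] at h3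
      exact hpv (hz h3)
    have h5 : coordL (z v) (z b) (z p) ≠ crossProd (z a - z v) (z b - z v) := by
      intro h4
      rw [h4, div_self hD.ne', one_smul, add_sub_cancel] at h3
      exact hpa (hz h3)
    apply h.vertex v a p hva
    rw [h3]
    exact add_smul_mem_openSegment (div_pos (hp1.lt_of_ne h4.symm) hD)
      ((div_lt_one hD).2 (hp3.lt_of_ne h5))
  refine hE p (h.adj_of_maximal hmax hpv.symm ?_ ?_) hs ht
  · rintro w ⟨α, β, hα, hβ, hαβ, hw⟩
    have hL := coordL_combo (z v) (z b) (z v) (z p) hαβ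
    have hR := coordR_combo (z v) (z a) (z v) (z p) hαβ
    rw [hw, coordL_self, mul_zero, zero_add] at hL
    rw [hw, coordR_self, mul_zero, zero_add] at hR
    have h1 : 0 < coordL (z v) (z b) (z w) := hL ▸ mul_pos hβ hs
    have h2 : 0 < coordR (z v) (z a) (z w) := hR ▸ mul_pos hβ ht
    have h3 : coordL (z v) (z b) (z w) + coordR (z v) (z a) (z w) <
      coordL (z v) (z b) (z p) + coordR (z v) (z a) (z p) := by rw [hL, hR]; nlinarith
    have := hmin w ⟨by rintro rfl; simp at h1, by rintro rfl; simp at h2, by rintro rfl; simp at h1,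
      h1.le, h2.le, by linarith⟩
    linarith
  · intro x y hxy m ⟨α, β, hα, hβ, hαβ, hw⟩ hm
    exfalso
    have hL := coordL_combo (z v) (z b) (z v) (z p) hαβ
    have hR := coordR_combo (z v) (z a) (z v) (z p) hαβ
    rw [hw, coordL_self, mul_zero, zero_add] at hL
    rw [hw, coordR_self, mul_zero, zero_add] at hR
    have h1 : 0 < coordL (z v) (z b) m := hL ▸ mul_pos hβ hs
    have h2 : 0 < coordR (z v) (z a) m := hR ▸ mul_pos hβ ht
    have h3 : coordL (z v) (z b) m + coordR (z v) (z a) m <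
      coordL (z v) (z b) (z p) + coordR (z v) (z a) (z p) := by rw [hL, hR]; nlinarith
    -- The nearer end of an edge crossing the segment `vp` would be an intruder with smaller L + R
    -- than `p`.
    have key : ∀ x y, H.Adj x y → m ∈ openSegment ℝ (z x) (z y) →
        coordL (z v) (z b) (z x) + coordR (z v) (z a) (z x) ≤
          coordL (z v) (z b) m + coordR (z v) (z a) m → False := by
      intro x y hxy hm hx
      obtain ⟨h4, h5, h6⟩ := h.end_mem_triangle hva hvb hD hE hxy hm h1 h2 (by linarith) hx
      have hDa : coordL (z v) (z b) (z a) = crossProd (z a - z v) (z b - z v) := rfl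
      have hDb : coordR (z v) (z a) (z b) = crossProd (z a - z v) (z b - z v) := rfl
      have := hmin x ⟨h4, by rintro rfl; simp [hDa] at hx; linarith,
        by rintro rfl; simp [hDb] at hx; linarith, h5, h6, by linarith⟩
      linarith
    have hm' := hm
    obtain ⟨α', β', hα', hβ', hαβ', hw'⟩ := hm
    have hL' := coordL_combo (z v) (z b) (z x) (z y) hαβ'
    have hR' := coordR_combo (z v) (z a) (z x) (z y) hαβ'
    rw [hw'] at hL' hR'
    rcases le_total (coordL (z v) (z b) (z x) + coordR (z v) (z a) (z x))
      (coordL (z v) (z b) m + coordR (z v) (z a) m) with hx | hx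
    · exact key x y hxy hm' hx
    · refine key y x hxy.symm (openSegment_symm ℝ (z x) (z y) ▸ hm') ?_
      have e1 : α' = 1 - β' := by linarith
      subst e1
      by_contra hc
      push Not at hc
      nlinarith

/-- In a maximal noncrossing drawing, an empty corner closes to a triangle. -/
theorem NonCrossing.adj_of_corner (h : NonCrossing z H) (hz : Function.Injective z)
    (hmax : ∀ H', NonCrossing z H' → H ≤ H' → H' ≤ H) {v a b : V}
    (hva : H.Adj v a) (hvb : H.Adj v b)
    (hD : 0 < crossProd (z a - z v) (z b - z v))
    (hE : ∀ d, H.Adj v d → 0 < coordL (z v) (z b) (z d) → 0 < coordR (z v) (z a) (z d) → False) :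
    H.Adj a b := by
  have hDa : coordL (z v) (z b) (z a) = crossProd (z a - z v) (z b - z v) := rfl
  have hDb : coordR (z v) (z a) (z b) = crossProd (z a - z v) (z b - z v) := rfl
  have hemp := h.triangle_empty hz hmax hva hvb hD hE
  have hab : a ≠ b := by rintro rfl; simp at hDa; linarith
  refine h.adj_of_maximal hmax hab ?_ ?_
  · rintro w ⟨α, β, hα, hβ, hαβ, hw⟩
    have hL := coordL_combo (z v) (z b) (z a) (z b) hαβ
    have hR := coordR_combo (z v) (z a) (z a) (z b) hαβ
    rw [hw, coordL_self_right, mul_zero, add_zero, hDa] at hL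
    rw [hw, coordR_self_right, mul_zero, zero_add, hDb] at hR
    have h1 := mul_pos hα hD
    have h2 := mul_pos hβ hD
    rcases hemp w (by linarith) (by linarith) (by rw [hL, hR, ← add_mul, hαβ, one_mul])
      with rfl | rfl | rfl
    · simp at hL; linarith [hL.resolve_right hD.ne']
    · simp at hR; linarith [hR.resolve_right hD.ne']
    · simp at hL; linarith [hL.resolve_right hD.ne']
  · intro x y hxy m ⟨α, β, hα, hβ, hαβ, hw⟩ hm
    have hL := coordL_combo (z v) (z b) (z a) (z b) hαβ
    have hR := coordR_combo (z v) (z a) (z a) (z b) hαβ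
    rw [hw, coordL_self_right, mul_zero, add_zero, hDa] at hL
    rw [hw, coordR_self_right, mul_zero, zero_add, hDb] at hR
    have h1 : 0 < coordL (z v) (z b) m := hL ▸ mul_pos hα hD
    have h2 : 0 < coordR (z v) (z a) m := hR ▸ mul_pos hβ hD
    have h3 : coordL (z v) (z b) m + coordR (z v) (z a) m = crossProd (z a - z v) (z b - z v) := by
      rw [hL, hR, ← add_mul, hαβ, one_mul]
    have key : ∀ x y, H.Adj x y → m ∈ openSegment ℝ (z x) (z y) →
        coordL (z v) (z b) (z x) + coordR (z v) (z a) (z x) ≤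
          coordL (z v) (z b) m + coordR (z v) (z a) m → H.Adj a b := by
      intro x y hxy hm hx
      obtain ⟨h4, h5, h6⟩ := h.end_mem_triangle hva hvb hD hE hxy hm h1 h2 (by linarith) hx
      obtain ⟨α', β', hα', hβ', hαβ', hw'⟩ := hm
      have hL' := coordL_combo (z v) (z b) (z x) (z y) hαβ'
      have hR' := coordR_combo (z v) (z a) (z x) (z y) hαβ'
      rw [hw'] at hL' hR'
      -- The nearer end is `a` or `b`, so the crossing edge runs along the line `ab`. Its other end
      -- cannot lie beyond the second corner vertex, which would then be inside the edge; hence the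
      -- edge is `ab` itself.
      rcases (hemp x h5 h6 (by linarith)).resolve_left h4 with rfl | rfl
      · simp only [coordR_self_right, mul_zero, zero_add] at hR'
        have hy : 0 < coordR (z v) (z x) (z y) := by
          rw [hR'] at h2; exact pos_of_mul_pos_right h2 hβ'.le
        have hsum : coordL (z v) (z b) (z y) + coordR (z v) (z x) (z y) =
            crossProd (z x - z v) (z b - z v) := by
          apply mul_left_cancel₀ hβ'.ne'
          have e1 : α' = 1 - β' := by linarith
          subst e1
          linear_combination h3 - hL' - hR' - (1 - β') * hDa
        by_cases hy2 : 0 ≤ coordL (z v) (z b) (z y)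
        · rcases hemp y hy2 hy.le hsum.le with rfl | rfl | rfl
          · simp at hy
          · exact absurd rfl hxy.ne
          · exact hxy
        · push Not at hy2
          exfalso
          apply h.vertex x y b hxy
          have h7 : z b = z x + (crossProd (z x - z v) (z b - z v) / coordR (z v) (z x) (z y)) •
              (z y - z x) := by
            have h8 := crossProd_smul_eq_coord (z v) (z x) (z b) (z y)
            rw [eq_sub_of_add_eq hsum] at h8
            have h9 : crossProd (z x - z v) (z b - z v) • (z y - z x) =
                coordR (z v) (z x) (z y) • (z b - z x) := by
              simp only [Complex.real_smul] at h8 ⊢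
              push_cast at h8
              linear_combination h8
            rw [div_eq_inv_mul, mul_smul, h9, smul_smul, inv_mul_cancel₀ hy.ne', one_smul,
              add_sub_cancel]
          rw [h7]
          exact add_smul_mem_openSegment (div_pos hD hy) ((div_lt_one hy).2 (by linarith))
      · simp only [coordL_self_right, mul_zero, zero_add] at hL'
        have hy : 0 < coordL (z v) (z x) (z y) := by
          rw [hL'] at h1; exact pos_of_mul_pos_right h1 hβ'.le
        have hsum : coordL (z v) (z x) (z y) + coordR (z v) (z a) (z y) =
            crossProd (z a - z v) (z x - z v) := by
          apply mul_left_cancel₀ hβ'.ne'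
          have e1 : α' = 1 - β' := by linarith
          subst e1
          linear_combination h3 - hL' - hR' - (1 - β') * hDb
        by_cases hy2 : 0 ≤ coordR (z v) (z a) (z y)
        · rcases hemp y hy.le hy2 hsum.le with rfl | rfl | rfl
          · simp at hy
          · exact hxy.symm
          · exact absurd rfl hxy.ne
        · push Not at hy2
          exfalso
          apply h.vertex x y a hxy
          have h7 : z a = z x + (crossProd (z a - z v) (z x - z v) / coordL (z v) (z x) (z y)) •
              (z y - z x) := by
            have h8 := crossProd_smul_eq_coord (z v) (z a) (z x) (z y)
            rw [eq_sub_of_add_eq' hsum] at h8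
            have h9 : crossProd (z a - z v) (z x - z v) • (z y - z x) =
                coordL (z v) (z x) (z y) • (z a - z x) := by
              simp only [Complex.real_smul] at h8 ⊢
              push_cast at h8
              linear_combination h8
            rw [div_eq_inv_mul, mul_smul, h9, smul_smul, inv_mul_cancel₀ hy.ne', one_smul,
              add_sub_cancel]
          rw [h7]
          exact add_smul_mem_openSegment (div_pos hD hy) ((div_lt_one hy).2 (by linarith))
    have hm' := hm
    obtain ⟨α', β', hα', hβ', hαβ', hw'⟩ := hm
    have hL' := coordL_combo (z v) (z b) (z x) (z y) hαβ'
    have hR' := coordR_combo (z v) (z a) (z x) (z y) hαβ'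
    rw [hw'] at hL' hR'
    rcases le_total (coordL (z v) (z b) (z x) + coordR (z v) (z a) (z x))
      (coordL (z v) (z b) m + coordR (z v) (z a) m) with hx | hx
    · exact key x y hxy hm' hx
    · refine key y x hxy.symm (openSegment_symm ℝ (z x) (z y) ▸ hm') ?_
      have e1 : α' = 1 - β' := by linarith
      subst e1
      by_contra hc
      push Not at hc
      nlinarith

/-- Near `a`, an edge from `a` into the angle `b a v` runs inside the triangle `v a b`. By
`NonCrossing.end_mem_triangle` its other end lies in the triangle too, which has no vertex to offer.
-/
theorem NonCrossing.corner_empty_at_next (h : NonCrossing z H) (hz : Function.Injective z)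
    (hmax : ∀ H', NonCrossing z H' → H ≤ H' → H' ≤ H) {v a b : V}
    (hva : H.Adj v a) (hvb : H.Adj v b)
    (hD : 0 < crossProd (z a - z v) (z b - z v))
    (hE : ∀ d, H.Adj v d → 0 < coordL (z v) (z b) (z d) → 0 < coordR (z v) (z a) (z d) → False) :
    ∀ d, H.Adj a d → 0 < coordL (z a) (z v) (z d) → 0 < coordR (z a) (z b) (z d) → False := by
  intro d hd h1 h2
  have hDa : coordL (z v) (z b) (z a) = crossProd (z a - z v) (z b - z v) := rfl
  have hDb : coordR (z v) (z a) (z b) = crossProd (z a - z v) (z b - z v) := rfl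
  have ht : 0 < coordR (z v) (z a) (z d) := by
    convert h1 using 1; simp [coordL, coordR, crossProd]; ring
  have hs : coordL (z v) (z b) (z d) + coordR (z v) (z a) (z d) <
      crossProd (z a - z v) (z b - z v) := by
    rw [← sub_pos]
    convert h2 using 1; simp [coordL, coordR, crossProd]; ring
  set D := crossProd (z a - z v) (z b - z v)
  set S := coordL (z v) (z b) (z d)
  set T := coordR (z v) (z a) (z d)
  -- The point (1 - ε) a + ε d must stay on the inner side of the line `vb`, even when S is
  -- negative.
  obtain ⟨ε, hε, hε1, hεS⟩ : ∃ ε : ℝ, 0 < ε ∧ ε < 1 ∧ 0 < (1 - ε) * D + ε * S := by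
    have hpos : 0 < D + |S| := by positivity
    refine ⟨D / (2 * (D + |S|)), by positivity, (div_lt_one (by positivity)).2 ?_, ?_⟩
    · have := abs_nonneg S; linarith
    · have h3 : D / (2 * (D + |S|)) * (D + |S|) = D / 2 := by field_simp
      have h4 := neg_abs_le S
      have h5 : 0 < D / (2 * (D + |S|)) := by positivity
      nlinarith
  have hsum : (1 - ε) + ε = 1 := by ring
  have hmL := coordL_combo (z v) (z b) (z a) (z d) hsum
  have hmR := coordR_combo (z v) (z a) (z a) (z d) hsum
  rw [coordR_self_right, mul_zero, zero_add] at hmR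
  rw [hDa] at hmL
  have hm : (1 - ε) • z a + ε • z d ∈ openSegment ℝ (z d) (z a) :=
    ⟨ε, 1 - ε, hε, by linarith, by ring, by rw [add_comm]⟩
  have h6 := h.end_mem_triangle hva hvb hD hE hd.symm hm (by rw [hmL]; exact hεS)
    (by rw [hmR]; exact mul_pos hε ht) (by rw [hmL, hmR]; nlinarith)
    (by rw [hmL, hmR]; nlinarith)
  rcases (h.triangle_empty hz hmax hva hvb hD hE d h6.2.1 h6.2.2 hs.le).resolve_left h6.1
    with rfl | rfl
  · exact hd.ne rfl
  · simp only [T, S, coordL_self_right] at hs; rw [hDb] at hs; linarith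

end Drawing

/-! ### Region labellings, and the labelling of a maximal drawing by triangles. -/

section Labels

open Classical Real

variable {V X : Type*} [Fintype V]

/-- The neighbours of `v`. -/
noncomputable def nbrs (H : SimpleGraph V) (v : V) : Finset V := Finset.univ.filter (H.Adj v)

@[simp] theorem mem_nbrs {H : SimpleGraph V} {v a : V} : a ∈ nbrs H v ↔ H.Adj v a := by
  simp [nbrs]

/-- The neighbour of `v` following `a` counterclockwise. -/
noncomputable def nextNbr (z : V → ℂ) (H : SimpleGraph V) (v a : V) : V :=
  nextDir (dirArg z v) (nbrs H v) a

/-- The angle at `v` between `a` and the neighbour following it counterclockwise. -/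
noncomputable def corner (z : V → ℂ) (H : SimpleGraph V) (v a : V) : ℝ :=
  cornerAngle (dirArg z v) (nbrs H v) a

/-- The darts (oriented edges) with label `L`. -/
noncomputable def labelDarts (H : SimpleGraph V) (ρ : V → V → Option X) (L : Option X) :
    Finset (V × V) :=
  Finset.univ.filter fun p => H.Adj p.1 p.2 ∧ ρ p.1 p.2 = L

@[simp] theorem mem_labelDarts {H : SimpleGraph V} {ρ : V → V → Option X} {L : Option X}
    {p : V × V} : p ∈ labelDarts H ρ L ↔ H.Adj p.1 p.2 ∧ ρ p.1 p.2 = L := by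
  simp [labelDarts]

/-- The total turning along the boundary of the region `L`. -/
noncomputable def turning (z : V → ℂ) (H : SimpleGraph V) (ρ : V → V → Option X)
    (L : Option X) : ℝ := ∑ p ∈ labelDarts H ρ L, (π - corner z H p.1 p.2)

/-- Twice the signed area enclosed by the boundary of the region `L`. -/
noncomputable def doubleArea (z : V → ℂ) (H : SimpleGraph V) (ρ : V → V → Option X)
    (L : Option X) : ℝ := ∑ p ∈ labelDarts H ρ L, crossProd (z p.1) (z p.2)

/-- A labelling of the darts of a drawn graph by the region to their left, where `none` labels
the outer region. -/
structure RegionLabelling (z : V → ℂ) (H : SimpleGraph V) (ρ : V → V → Option X) : Prop where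
  next : ∀ v a, H.Adj v a → ρ (nextNbr z H v a) v = ρ v a
  turning_inner : ∀ x, (labelDarts H ρ (some x)).Nonempty →
    ∃ τ : ℤ, τ ≤ 1 ∧ turning z H ρ (some x) = 2 * π * τ
  area_inner : ∀ x, (labelDarts H ρ (some x)).Nonempty → 0 < doubleArea z H ρ (some x)
  turning_outer : turning z H ρ none ≤ 0

variable {z : V → ℂ} {H : SimpleGraph V}

theorem nextNbr_adj {v a : V} (h : H.Adj v a) : H.Adj v (nextNbr z H v a) :=
  mem_nbrs.1 (nextDir_mem _ ⟨a, mem_nbrs.2 h⟩ _)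

theorem corner_pos (v a : V) : 0 < corner z H v a := cornerAngle_pos (dirArg_mem z v) a

theorem corner_eq (v a : V) :
    corner z H v a = ccwGap (dirArg z v a) (dirArg z v (nextNbr z H v a)) := rfl

theorem NonCrossing.dirArg_injOn_nbrs (h : NonCrossing z H) (hz : Function.Injective z) (v : V) :
    Set.InjOn (dirArg z v) (nbrs H v) := by
  convert h.dirArg_inj hz v using 1
  ext; simp

theorem corner_lt_pi_iff (hz : Function.Injective z) {v a : V} (ha : H.Adj v a) :
    corner z H v a < π ↔ 0 < crossProd (z a - z v) (z (nextNbr z H v a) - z v) :=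
  ccwGap_lt_pi_iff (sub_ne_zero.2 (fun hh => ha.ne (hz hh).symm))
    (sub_ne_zero.2 (fun hh => (nextNbr_adj (z := z) ha).ne (hz hh).symm))

/-- The positive coordinates say that both gaps, from `a` to `d` and from `d` to the successor of
`a`, are below π. This would put `d` strictly between `a` and its successor. -/
theorem empty_corner (hz : Function.Injective z) {v a : V} (ha : H.Adj v a)
    (d : V) (hd : H.Adj v d) (hs : 0 < coordL (z v) (z (nextNbr z H v a)) (z d))
    (ht : 0 < coordR (z v) (z a) (z d)) : False := by
  have hane : z a - z v ≠ 0 := sub_ne_zero.2 (fun hh => ha.ne (hz hh).symm)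
  have hdne : z d - z v ≠ 0 := sub_ne_zero.2 (fun hh => hd.ne (hz hh).symm)
  have hb := nextNbr_adj (z := z) ha
  have hbne : z (nextNbr z H v a) - z v ≠ 0 := sub_ne_zero.2 (fun hh => hb.ne (hz hh).symm)
  have h1 := (ccwGap_lt_pi_iff hane hdne).2 ht
  have h2 := (ccwGap_lt_pi_iff hdne hbne).2 hs
  have h3 := cornerAngle_le (dirArg z v) a (mem_nbrs.2 hd)
  rcases h3.lt_or_eq with h4 | h4
  · have h5 := ccwGap_add_of_lt (dirArg_mem z v _) (dirArg_mem z v _) (dirArg_mem z v _) h4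
    have h6 := ccwGap_pos (dirArg_mem z v a) (dirArg_mem z v (nextNbr z H v a))
    change ccwGap _ _ = ccwGap (dirArg z v a) (dirArg z v (nextNbr z H v a)) +
      ccwGap (dirArg z v (nextNbr z H v a)) _ at h5
    unfold dirArg at *
    unfold ccwGap at *
    split_ifs at * <;> linarith [Real.pi_pos]
  · have h5 := ccwGap_right_inj (dirArg_mem z v _) (dirArg_mem z v _) h4
    change dirArg z v (nextNbr z H v a) = dirArg z v d at h5
    unfold dirArg at h5
    rw [h5, ccwGap_self] at h2
    linarith [Real.pi_pos]

/-- In a maximal noncrossing drawing, a corner smaller than `π` belongs to a triangle, and the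
next corner of that triangle is again smaller than `π`. -/
theorem NonCrossing.next_corner (h : NonCrossing z H) (hz : Function.Injective z)
    (hmax : ∀ H', NonCrossing z H' → H ≤ H' → H' ≤ H) {v a : V} (ha : H.Adj v a)
    (hlt : corner z H v a < π) :
    H.Adj a (nextNbr z H v a) ∧ nextNbr z H a (nextNbr z H v a) = v ∧
      corner z H a (nextNbr z H v a) < π := by
  have hb := nextNbr_adj (z := z) ha
  have hD := (corner_lt_pi_iff hz ha).1 hlt
  have hE := empty_corner hz ha
  set b := nextNbr z H v a
  have hab := h.adj_of_corner hz hmax ha hb hD hE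
  have hE' := h.corner_empty_at_next hz hmax ha hb hD hE
  have hD' : 0 < crossProd (z b - z a) (z v - z a) := by
    convert hD using 1; simp [crossProd]; ring
  have hvne : z v - z a ≠ 0 := sub_ne_zero.2 (fun hh => ha.ne (hz hh))
  have hbne : z b - z a ≠ 0 := sub_ne_zero.2 (fun hh => hab.ne (hz hh).symm)
  have hn : nextNbr z H a b = v := by
    refine nextDir_eq_of_forall_le (dirArg_mem z a) (h.dirArg_injOn_nbrs hz a)
      (mem_nbrs.2 ha.symm) ?_
    intro d hd
    rw [mem_nbrs] at hd
    by_contra hcon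
    push Not at hcon
    have hdne : z d - z a ≠ 0 := sub_ne_zero.2 (fun hh => hd.ne (hz hh).symm)
    have h1 := (ccwGap_lt_pi_iff hbne hvne).2 hD'
    have h2 := ccwGap_add_of_lt (dirArg_mem z a _) (dirArg_mem z a _) (dirArg_mem z a _) hcon
    have h3 := ccwGap_pos (dirArg_mem z a b) (dirArg_mem z a d)
    refine hE' d hd ((ccwGap_lt_pi_iff hdne hvne).1 ?_) ((ccwGap_lt_pi_iff hbne hdne).1 ?_)
    · unfold dirArg at *; linarith
    · unfold dirArg at *; linarith
  refine ⟨hab, hn, ?_⟩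
  rw [corner_lt_pi_iff hz hab, hn]
  exact hD'

omit [Fintype V] in
-- Modulo 2π the sum is π, since reversing a segment adds π to its direction. Each gap is in (0, π),
-- so the sum lies in (0, 3π) and equals π exactly.
theorem triangle_angle_sum (hz : Function.Injective z) {v a b : V} (hva : v ≠ a) (hab : a ≠ b)
    (hbv : b ≠ v) (h1 : ccwGap (dirArg z v a) (dirArg z v b) < π)
    (h2 : ccwGap (dirArg z a b) (dirArg z a v) < π)
    (h3 : ccwGap (dirArg z b v) (dirArg z b a) < π) :
    ccwGap (dirArg z v a) (dirArg z v b) + ccwGap (dirArg z a b) (dirArg z a v) +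
      ccwGap (dirArg z b v) (dirArg z b a) = π := by
  have key : ((ccwGap (dirArg z v a) (dirArg z v b) + ccwGap (dirArg z a b) (dirArg z a v) +
      ccwGap (dirArg z b v) (dirArg z b a) : ℝ) : Real.Angle) = (π : ℝ) := by
    have hflip : ∀ {p q : V}, p ≠ q → ((dirArg z p q : ℝ) : Real.Angle) = dirArg z q p + (π : ℝ) := by
      intro p q hpq
      unfold dirArg
      rw [← Complex.arg_neg_coe_angle (sub_ne_zero.2 (fun hh => hpq (hz hh))), neg_sub]
    rw [Real.Angle.coe_add, Real.Angle.coe_add, coe_ccwGap, coe_ccwGap, coe_ccwGap, hflip hva,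
      hflip hab, hflip hbv]
    have h2pi : ((π : ℝ) : Real.Angle) + (π : ℝ) = 0 := Real.Angle.coe_pi_add_coe_pi
    generalize ((dirArg z a v : ℝ) : Real.Angle) = x
    generalize ((dirArg z b a : ℝ) : Real.Angle) = w
    generalize ((dirArg z v b : ℝ) : Real.Angle) = y
    generalize ((π : ℝ) : Real.Angle) = p at h2pi ⊢
    have h4 : p = -p := eq_neg_of_add_eq_zero_left h2pi
    calc _ = -p - (p + p) := by abel
      _ = p := by rw [h2pi, sub_zero, ← h4]
  obtain ⟨k, hk⟩ := Real.Angle.angle_eq_iff_two_pi_dvd_sub.1 key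
  have p1 := ccwGap_pos (dirArg_mem z v a) (dirArg_mem z v b)
  have p2 := ccwGap_pos (dirArg_mem z a b) (dirArg_mem z a v)
  have p3 := ccwGap_pos (dirArg_mem z b v) (dirArg_mem z b a)
  have hk1 : (k : ℝ) < 1 := by
    by_contra hc; push Not at hc; nlinarith [Real.pi_pos]
  have hk2 : (-1 : ℝ) < k := by
    by_contra hc; push Not at hc; nlinarith [Real.pi_pos]
  have : k = 0 := by
    have h5 : k < 1 := by exact_mod_cast hk1
    have h6 : -1 < k := by exact_mod_cast hk2
    omega
  rw [this] at hk
  simp at hk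
  linarith

/-- The labelling of a maximal noncrossing drawing by its triangles. -/
noncomputable def triangleLabel (z : V → ℂ) (H : SimpleGraph V) (v a : V) :
    Option (Finset V) :=
  if corner z H v a < π then some {v, a, nextNbr z H v a} else none

theorem labelDarts_triangleLabel (h : NonCrossing z H) (hz : Function.Injective z)
    (hmax : ∀ H', NonCrossing z H' → H ≤ H' → H' ≤ H) {v a : V} (ha : H.Adj v a)
    (hlt : corner z H v a < π) :
    labelDarts H (triangleLabel z H) (some {v, a, nextNbr z H v a}) =
      {(v, a), (a, nextNbr z H v a), (nextNbr z H v a, v)} := by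
  obtain ⟨hab, h1, h2⟩ := h.next_corner hz hmax ha hlt
  obtain ⟨hbv, h3, h4⟩ := h.next_corner hz hmax hab h2
  have hD := (corner_lt_pi_iff hz ha).1 hlt
  rw [h1] at h3 h4 hbv
  set b := nextNbr z H v a with hb
  ext ⟨u, c⟩
  simp only [mem_labelDarts, triangleLabel, Finset.mem_insert, Finset.mem_singleton, Prod.mk.injEq]
  constructor
  · rintro ⟨huc, hx⟩
    split_ifs at hx with hlt'
    have hD' := (corner_lt_pi_iff hz huc).1 hlt'
    have hcd := (h.next_corner hz hmax huc hlt').1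
    have hdu := (nextNbr_adj (z := z) huc)
    set d := nextNbr z H u c
    rw [Option.some.injEq] at hx
    have hu : u ∈ ({v, a, b} : Finset V) := hx ▸ by simp
    have hc : c ∈ ({v, a, b} : Finset V) := hx ▸ by simp
    have hd : d ∈ ({v, a, b} : Finset V) := hx ▸ by simp
    simp only [Finset.mem_insert, Finset.mem_singleton] at hu hc hd
    have huc' := huc.ne
    have hcd' := hcd.ne
    have hdu' := hdu.ne
    -- Only the cyclic rotations of `(v, a, b)` survive: repeated vertices contradict adjacency, and
    -- odd permutations reverse the sign of the cross product.
    rcases hu with hu | hu | hu <;> rcases hc with hc | hc | hc <;>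
      rcases hd with hd | hd | hd <;>
      first
        | (exfalso; exact huc' (hu.trans hc.symm))
        | (exfalso; exact hcd' (hc.trans hd.symm))
        | (exfalso; exact hdu' (hu.trans hd.symm))
        | (simp [hu, hc]; done)
        | (exfalso; rw [hu, hc, hd] at hD'; simp [crossProd] at hD hD'; linarith)
  · rintro (⟨rfl, rfl⟩ | ⟨rfl, rfl⟩ | ⟨rfl, rfl⟩)
    · exact ⟨ha, by rw [if_pos hlt]⟩
    · refine ⟨hab, ?_⟩
      rw [if_pos h2, h1]
      congr 1; ext; simp; tauto
    · refine ⟨hbv, ?_⟩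
      rw [if_pos h4, h3]
      congr 1; ext; simp; tauto

/-- Every inner label is one positively oriented triangle, with turning exactly 2π. Outer corners
are at least π, so each term of the outer turning is nonpositive. -/
theorem regionLabelling_triangleLabel (h : NonCrossing z H) (hz : Function.Injective z)
    (hmax : ∀ H', NonCrossing z H' → H ≤ H' → H' ≤ H) :
    RegionLabelling z H (triangleLabel z H) := by
  have key : ∀ x, (labelDarts H (triangleLabel z H) (some x)).Nonempty → ∃ v a,
      H.Adj v a ∧ corner z H v a < π ∧ x = {v, a, nextNbr z H v a} := by
    rintro x ⟨⟨v, a⟩, hva⟩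
    simp only [mem_labelDarts, triangleLabel] at hva
    obtain ⟨hva, hx⟩ := hva
    split_ifs at hx with hlt
    exact ⟨v, a, hva, hlt, (Option.some.inj hx).symm⟩
  have hsum : ∀ {v a : V}, H.Adj v a → corner z H v a < π → ∀ F : V × V → ℝ,
      ∑ p ∈ labelDarts H (triangleLabel z H) (some {v, a, nextNbr z H v a}), F p =
        F (v, a) + F (a, nextNbr z H v a) + F (nextNbr z H v a, v) := by
    intro v a ha hlt F
    have hab := (h.next_corner hz hmax ha hlt).1
    have hvb := nextNbr_adj (z := z) ha
    rw [labelDarts_triangleLabel h hz hmax ha hlt, Finset.sum_insert, Finset.sum_insert,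
      Finset.sum_singleton, add_assoc]
    · simp only [Finset.mem_singleton, Prod.mk.injEq, not_and]
      exact fun hh => absurd hh hab.ne
    · simp only [Finset.mem_insert, Finset.mem_singleton, Prod.mk.injEq, not_or, not_and]
      exact ⟨fun hh => absurd hh ha.ne, fun hh => absurd hh hvb.ne⟩
  refine ⟨?_, ?_, ?_, ?_⟩
  · intro v a ha
    have hb := nextNbr_adj (z := z) ha
    by_cases hlt : corner z H v a < π
    · obtain ⟨hab, h1, h2⟩ := h.next_corner hz hmax ha hlt
      obtain ⟨hbv, h3, h4⟩ := h.next_corner hz hmax hab h2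
      rw [h1] at h3 h4
      unfold triangleLabel
      rw [if_pos hlt, if_pos h4, h3]
      congr 1; ext; simp; tauto
    · have : ¬ corner z H (nextNbr z H v a) v < π := by
        intro hlt'
        obtain ⟨hbc, h1, h2⟩ := h.next_corner hz hmax hb.symm hlt'
        have := nextDir_injOn (dirArg_mem z v) (h.dirArg_injOn_nbrs hz v)
          (mem_nbrs.2 hbc) (mem_nbrs.2 ha) h1
        rw [this] at h2
        exact hlt h2
      unfold triangleLabel
      rw [if_neg hlt, if_neg this]
  · intro x hx
    obtain ⟨v, a, ha, hlt, rfl⟩ := key x hx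
    obtain ⟨hab, h1, h2⟩ := h.next_corner hz hmax ha hlt
    obtain ⟨hbv, h3, h4⟩ := h.next_corner hz hmax hab h2
    have hs := triangle_angle_sum hz ha.ne hab.ne (nextNbr_adj (z := z) ha).ne.symm hlt
      (by have := h2; rw [corner_eq, h1] at this; exact this)
      (by have := h4; rw [h1] at this h3; rw [corner_eq, h3] at this; exact this)
    refine ⟨1, le_rfl, ?_⟩
    unfold turning
    rw [hsum ha hlt]
    simp only [corner_eq]
    rw [h1] at h3 ⊢
    rw [h3]
    push_cast
    linarith
  · intro x hx
    obtain ⟨v, a, ha, hlt, rfl⟩ := key x hx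
    unfold doubleArea
    rw [hsum ha hlt]
    have hD := (corner_lt_pi_iff hz ha).1 hlt
    convert hD using 1
    simp [crossProd]; ring
  · unfold turning
    apply Finset.sum_nonpos
    rintro ⟨v, a⟩ hp
    simp only [mem_labelDarts, triangleLabel] at hp
    obtain ⟨-, hx⟩ := hp
    split_ifs at hx with hlt
    push Not at hlt
    simp only; linarith

end Labels

/-! ### Deleting edges and merging labels, down to the given graph. -/

section Deletion

open Classical Real

variable {V X : Type*} [Fintype V] {z : V → ℂ} {H : SimpleGraph V}

theorem nbrs_deleteEdges_left {v w : V} :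
    nbrs (H.deleteEdges {s(v, w)}) v = (nbrs H v).erase w := by
  ext a
  simp only [mem_nbrs, SimpleGraph.deleteEdges_adj, Set.mem_singleton_iff, Finset.mem_erase,
    Sym2.eq_iff]
  constructor
  · rintro ⟨h1, h2⟩
    exact ⟨fun h => h2 (Or.inl ⟨trivial, h⟩), h1⟩
  · rintro ⟨h1, h2⟩
    refine ⟨h2, ?_⟩
    rintro (⟨-, h⟩ | ⟨rfl, rfl⟩)
    · exact h1 h
    · exact h1 rfl

theorem nbrs_deleteEdges_right {v w : V} :
    nbrs (H.deleteEdges {s(v, w)}) w = (nbrs H w).erase v := by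
  rw [Sym2.eq_swap, nbrs_deleteEdges_left]

theorem nbrs_deleteEdges_of_ne {v w u : V} (hv : u ≠ v) (hw : u ≠ w) :
    nbrs (H.deleteEdges {s(v, w)}) u = nbrs H u := by
  ext a
  simp only [mem_nbrs, SimpleGraph.deleteEdges_adj, Set.mem_singleton_iff, Sym2.eq_iff]
  tauto

theorem next_label_erase {ρ : V → V → Option X} (hinj : ∀ v, Set.InjOn (dirArg z v) (nbrs H v))
    (hρ : ∀ v a, H.Adj v a → ρ (nextNbr z H v a) v = ρ v a) {v w : V} (hvw : H.Adj v w)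
    {m : Option X → Option X} (hm : m (ρ v w) = m (ρ w v)) {a : V}
    (ha : a ∈ (nbrs H v).erase w) :
    m (ρ (nextDir (dirArg z v) ((nbrs H v).erase w) a) v) = m (ρ v a) := by
  have ha' := Finset.mem_of_mem_erase ha
  by_cases h : nextDir (dirArg z v) (nbrs H v) a = w
  · rw [(nextDir_erase_of_eq (dirArg_mem z v) (hinj v) (mem_nbrs.2 hvw) ha'
      (Finset.ne_of_mem_erase ha) h).1]
    have h1 := hρ v w hvw
    have h2 := hρ v a (mem_nbrs.1 ha')
    unfold nextNbr at h1 h2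
    rw [h] at h2
    rw [h1, ← h2, hm]
  · rw [nextDir_erase_of_ne (dirArg_mem z v) (hinj v) ha' h]
    exact congrArg m (hρ v a (mem_nbrs.1 ha'))

/-- Erasing `w` joins the corner ending at `w` to the one starting at `w`. By the label rule around
`v` these corners carry `ρ w v` and `ρ v w`, which `m` identifies, so the joined angle stays in its
class. Another neighbour must remain, or the corner would vanish. -/
theorem sum_corner_erase {ρ : V → V → Option X} (hinj : ∀ v, Set.InjOn (dirArg z v) (nbrs H v))
    (hρ : ∀ v a, H.Adj v a → ρ (nextNbr z H v a) v = ρ v a) {v w : V} (hvw : H.Adj v w)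
    {m : Option X → Option X} (hm : m (ρ v w) = m (ρ w v))
    (hne : ((nbrs H v).erase w).Nonempty) (L : Option X) :
    ∑ a ∈ ((nbrs H v).erase w).filter (fun a => m (ρ v a) = L),
      cornerAngle (dirArg z v) ((nbrs H v).erase w) a =
    ∑ a ∈ (nbrs H v).filter (fun a => m (ρ v a) = L), cornerAngle (dirArg z v) (nbrs H v) a := by
  obtain ⟨p, hp, hpw⟩ := exists_nextDir_eq (dirArg_mem z v) (hinj v) (mem_nbrs.2 hvw)
  refine sum_cornerAngle_erase (dirArg_mem z v) (hinj v) (mem_nbrs.2 hvw) hp ?_ hpw _ ?_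
  · rintro rfl
    rw [(nextDir_eq_self_iff (dirArg_mem z v) (hinj v) hp).1 hpw] at hne
    simp at hne
  · have h2 := hρ v p (mem_nbrs.1 hp)
    unfold nextNbr at h2
    rw [hpw] at h2
    rw [← h2, hm]

theorem sum_labelDarts (ρ : V → V → Option X) (L : Option X) (F : V × V → ℝ) :
    ∑ p ∈ labelDarts H ρ L, F p = ∑ v, ∑ a ∈ (nbrs H v).filter (fun a => ρ v a = L), F (v, a) := by
  unfold labelDarts nbrs
  rw [Finset.sum_filter, Fintype.sum_prod_type]
  refine Finset.sum_congr rfl fun v _ => ?_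
  rw [Finset.filter_filter, Finset.sum_filter]

theorem sum_labelDarts_deleteEdges {ρ : V → V → Option X} {v w : V} (hvw : H.Adj v w)
    (hm : ρ v w = ρ w v) (L : Option X) (F : V × V → ℝ) :
    ∑ p ∈ labelDarts (H.deleteEdges {s(v, w)}) ρ L, F p =
      ∑ p ∈ labelDarts H ρ L, F p - if L = ρ v w then F (v, w) + F (w, v) else 0 := by
  by_cases h : L = ρ v w
  · rw [if_pos h]
    have : labelDarts (H.deleteEdges {s(v, w)}) ρ L =
        ((labelDarts H ρ L).erase (v, w)).erase (w, v) := by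
      ext ⟨u, c⟩
      simp only [mem_labelDarts, SimpleGraph.deleteEdges_adj, Set.mem_singleton_iff,
        Finset.mem_erase, Sym2.eq_iff, ne_eq, Prod.mk.injEq]
      tauto
    have h1 : (v, w) ∈ labelDarts H ρ L := mem_labelDarts.2 ⟨hvw, h.symm⟩
    have h2 : (w, v) ∈ (labelDarts H ρ L).erase (v, w) :=
      Finset.mem_erase.2 ⟨by simp [hvw.ne'], mem_labelDarts.2 ⟨hvw.symm, (h.trans hm).symm⟩⟩
    rw [this, ← Finset.add_sum_erase _ _ h1, ← Finset.add_sum_erase _ _ h2]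
    ring
  · rw [if_neg h, sub_zero]
    refine Finset.sum_congr ?_ fun _ _ => rfl
    ext ⟨u, c⟩
    simp only [mem_labelDarts, SimpleGraph.deleteEdges_adj, Set.mem_singleton_iff, Sym2.eq_iff]
    refine ⟨fun hh => ⟨hh.1.1, hh.2⟩, fun hh => ⟨⟨hh.1, ?_⟩, hh.2⟩⟩
    rintro (⟨rfl, rfl⟩ | ⟨rfl, rfl⟩)
    · exact h hh.2.symm
    · exact h (hh.2.symm.trans hm.symm)

theorem sum_corner_deleteEdges {ρ : V → V → Option X}
    (hinj : ∀ v, Set.InjOn (dirArg z v) (nbrs H v))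
    (hρ : ∀ v a, H.Adj v a → ρ (nextNbr z H v a) v = ρ v a) {v w : V} (hvw : H.Adj v w)
    {m : Option X → Option X} (hm : m (ρ v w) = m (ρ w v))
    (hne : ∀ u, (nbrs (H.deleteEdges {s(v, w)}) u).Nonempty) (L : Option X) :
    ∑ p ∈ labelDarts (H.deleteEdges {s(v, w)}) (fun u a => m (ρ u a)) L,
      corner z (H.deleteEdges {s(v, w)}) p.1 p.2 =
    ∑ p ∈ labelDarts H (fun u a => m (ρ u a)) L, corner z H p.1 p.2 := by
  rw [sum_labelDarts, sum_labelDarts]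
  refine Finset.sum_congr rfl fun u _ => ?_
  simp only [corner]
  by_cases huv : u = v
  · subst huv
    have := hne u
    rw [nbrs_deleteEdges_left] at this ⊢
    exact sum_corner_erase hinj hρ hvw hm this L
  by_cases huw : u = w
  · subst huw
    have := hne u
    rw [nbrs_deleteEdges_right] at this ⊢
    exact sum_corner_erase hinj hρ hvw.symm hm.symm this L
  · rw [nbrs_deleteEdges_of_ne huv huw]

/-- The corner angles of each merged class are conserved, while two darts disappear from the merged
label, each having contributed π. -/
theorem turning_deleteEdges {ρ : V → V → Option X}
    (hinj : ∀ v, Set.InjOn (dirArg z v) (nbrs H v))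
    (hρ : ∀ v a, H.Adj v a → ρ (nextNbr z H v a) v = ρ v a) {v w : V} (hvw : H.Adj v w)
    {m : Option X → Option X} (hm : m (ρ v w) = m (ρ w v))
    (hne : ∀ u, (nbrs (H.deleteEdges {s(v, w)}) u).Nonempty) (L : Option X) :
    turning z (H.deleteEdges {s(v, w)}) (fun u a => m (ρ u a)) L =
      turning z H (fun u a => m (ρ u a)) L - if L = m (ρ v w) then 2 * π else 0 := by
  unfold turning
  rw [Finset.sum_sub_distrib, Finset.sum_sub_distrib, sum_corner_deleteEdges hinj hρ hvw hm hne,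
    sum_labelDarts_deleteEdges (ρ := fun u a => m (ρ u a)) hvw hm]
  split_ifs <;> ring

theorem doubleArea_deleteEdges {ρ : V → V → Option X} {v w : V} (hvw : H.Adj v w)
    (hm : ρ v w = ρ w v) (L : Option X) :
    doubleArea z (H.deleteEdges {s(v, w)}) ρ L = doubleArea z H ρ L := by
  unfold doubleArea
  rw [sum_labelDarts_deleteEdges hvw hm]
  have : crossProd (z v) (z w) + crossProd (z w) (z v) = 0 := by simp [crossProd]; ring
  rw [this]; simp

/-- Identify the labels `p` and `q`; the outer label absorbs the other one. -/
noncomputable def mergeLabel (p q : Option X) (L : Option X) : Option X :=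
  if L = p ∨ L = q then (if q = none then none else p) else L

/-- The case `p = q` is that of an edge with the same region on both sides, whose darts must not be
counted twice. -/
theorem sum_labelDarts_merge (ρ : V → V → Option X) (p q L : Option X) (F : V × V → ℝ) :
    ∑ x ∈ labelDarts H (fun u a => mergeLabel p q (ρ u a)) L, F x =
      if L = mergeLabel p q p then
        (if p = q then ∑ x ∈ labelDarts H ρ p, F x
          else ∑ x ∈ labelDarts H ρ p, F x + ∑ x ∈ labelDarts H ρ q, F x)
      else if L = p ∨ L = q then 0 else ∑ x ∈ labelDarts H ρ L, F x := by
  have hpe : mergeLabel p q p = if q = none then none else p := by simp [mergeLabel]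
  have hpq : mergeLabel p q p = p ∨ mergeLabel p q p = q := by
    rw [hpe]; split_ifs with h
    · exact Or.inr h.symm
    · exact Or.inl rfl
  by_cases h : L = mergeLabel p q p
  · rw [if_pos h]
    have hL : labelDarts H (fun u a => mergeLabel p q (ρ u a)) L =
        labelDarts H ρ p ∪ labelDarts H ρ q := by
      ext ⟨u, c⟩
      simp only [mem_labelDarts, Finset.mem_union, h]
      rw [← and_or_left]
      refine and_congr_right fun _ => ?_
      constructor
      · intro h1
        by_contra hcon
        unfold mergeLabel at h1
        rw [if_neg hcon] at h1
        exact hcon (h1 ▸ hpq)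
      · rintro (h1 | h1)
        · rw [h1]
        · rw [h1]; simp [mergeLabel]
    rw [hL]
    split_ifs with h1
    · rw [h1, Finset.union_self]
    · rw [Finset.sum_union]
      rw [Finset.disjoint_left]
      intro x hx hx'
      rw [mem_labelDarts] at hx hx'
      exact h1 (hx.2.symm.trans hx'.2)
  · rw [if_neg h]
    split_ifs with h1
    · apply Finset.sum_eq_zero
      intro x hx
      exfalso
      rw [mem_labelDarts] at hx
      apply h
      have h2 := hx.2
      unfold mergeLabel at h2
      split_ifs at h2 with h3 h4
      · rw [← h2, hpe, if_pos h4]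
      · rw [← h2, hpe, if_neg h4]
      · rw [h2] at h3; exact absurd h1 h3
    · refine Finset.sum_congr ?_ fun _ _ => rfl
      ext ⟨u, c⟩
      simp only [mem_labelDarts]
      refine and_congr_right fun _ => ?_
      unfold mergeLabel
      split_ifs with h3 h4
      · rw [hpe, if_pos h4] at h
        refine ⟨fun hh => absurd hh.symm h, fun hh => absurd (hh ▸ h3) h1⟩
      · rw [hpe, if_neg h4] at h
        refine ⟨fun hh => absurd hh.symm h, fun hh => absurd (hh ▸ h3) h1⟩
      · rfl

/-- Deleting an edge merges the two regions it separates. -/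
theorem RegionLabelling.deleteEdges {ρ : V → V → Option X} (h : RegionLabelling z H ρ)
    (hinj : ∀ v, Set.InjOn (dirArg z v) (nbrs H v)) {v w : V} (hvw : H.Adj v w)
    (hne : ∀ u, (nbrs (H.deleteEdges {s(v, w)}) u).Nonempty) :
    RegionLabelling z (H.deleteEdges {s(v, w)})
      (fun u a => mergeLabel (ρ v w) (ρ w v) (ρ u a)) := by
  set p := ρ v w with hp
  set q := ρ w v with hq
  have hm : mergeLabel p q (ρ v w) = mergeLabel p q (ρ w v) := by
    rw [← hp, ← hq]; simp [mergeLabel]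
  have hpe : mergeLabel p q p = if q = none then none else p := by simp [mergeLabel]
  have hturn : ∀ L, turning z (H.deleteEdges {s(v, w)}) (fun u a => mergeLabel p q (ρ u a)) L =
      turning z H (fun u a => mergeLabel p q (ρ u a)) L -
        if L = mergeLabel p q p then 2 * π else 0 := turning_deleteEdges hinj h.next hvw hm hne
  have harea := doubleArea_deleteEdges (z := z) (ρ := fun u a => mergeLabel p q (ρ u a)) hvw hm
  have hpn : (labelDarts H ρ p).Nonempty := ⟨(v, w), by simp [hvw, hp]⟩
  have hqn : (labelDarts H ρ q).Nonempty := ⟨(w, v), by simp [hvw.symm, hq]⟩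
  have hcase : ∀ x, (labelDarts (H.deleteEdges {s(v, w)})
      (fun u a => mergeLabel p q (ρ u a)) (some x)).Nonempty →
      (some x = mergeLabel p q p ∧ p = some x ∧ ∃ y, q = some y) ∨
      (some x ≠ mergeLabel p q p ∧ some x ≠ p ∧ some x ≠ q ∧
        (labelDarts H ρ (some x)).Nonempty) := by
    rintro x ⟨⟨u, a⟩, hx⟩
    simp only [mem_labelDarts, SimpleGraph.deleteEdges_adj] at hx
    obtain ⟨⟨hua, -⟩, hx⟩ := hx
    unfold mergeLabel at hx
    split_ifs at hx with h1 h2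
    · left
      rw [hpe, if_neg h2]
      exact ⟨hx.symm, hx, Option.ne_none_iff_exists'.1 h2⟩
    · right
      rw [hx] at h1
      push Not at h1
      refine ⟨?_, h1.1, h1.2, ⟨(u, a), by simp [hua, hx]⟩⟩
      rw [hpe]; split_ifs
      · simp
      · exact h1.1
  refine ⟨?_, ?_, ?_, ?_⟩
  · intro u a hua
    have ha : a ∈ nbrs (H.deleteEdges {s(v, w)}) u := mem_nbrs.2 hua
    unfold nextNbr
    by_cases huv : u = v
    · subst huv
      rw [nbrs_deleteEdges_left] at ha ⊢
      exact next_label_erase hinj h.next hvw hm ha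
    by_cases huw : u = w
    · subst huw
      rw [nbrs_deleteEdges_right] at ha ⊢
      exact next_label_erase hinj h.next hvw.symm hm.symm ha
    · rw [nbrs_deleteEdges_of_ne huv huw] at ha ⊢
      exact congrArg _ (h.next u a (mem_nbrs.1 ha))
  · intro x hx
    rw [hturn]
    unfold turning
    rw [sum_labelDarts_merge]
    rcases hcase x hx with ⟨h1, h2, y, h3⟩ | ⟨h1, h2, h3, h4⟩
    · rw [if_pos h1, if_pos h1]
      obtain ⟨τ, hτ, ht⟩ := h.turning_inner x (h2 ▸ hpn)
      obtain ⟨σ, hσ, hs⟩ := h.turning_inner y (h3 ▸ hqn)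
      unfold turning at ht hs
      -- The loss of 2π turns τ into τ - 1, or the pair τ, σ into τ + σ - 1; both remain at most 1.
      by_cases h4 : p = q
      · rw [if_pos h4]
        refine ⟨τ - 1, by omega, ?_⟩
        rw [h2, ht]; push_cast; ring
      · rw [if_neg h4]
        refine ⟨τ + σ - 1, by omega, ?_⟩
        rw [h2, h3, ht, hs]; push_cast; ring
    · rw [if_neg h1, if_neg (by tauto : ¬ (some x = p ∨ some x = q)), if_neg h1]
      obtain ⟨τ, hτ, ht⟩ := h.turning_inner x h4
      unfold turning at ht
      exact ⟨τ, hτ, by rw [ht]; ring⟩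
  · intro x hx
    rw [harea]
    unfold doubleArea
    rw [sum_labelDarts_merge]
    rcases hcase x hx with ⟨h1, h2, y, h3⟩ | ⟨h1, h2, h3, h4⟩
    · rw [if_pos h1]
      have hA := h.area_inner x (h2 ▸ hpn)
      have hB := h.area_inner y (h3 ▸ hqn)
      unfold doubleArea at hA hB
      rw [h2, h3]
      split_ifs <;> linarith
    · rw [if_neg h1, if_neg (by tauto)]
      exact h.area_inner x h4
  · rw [hturn]
    unfold turning
    rw [sum_labelDarts_merge]
    -- When the outer region absorbs another one, that one adds at most 2π of turning, and the
    -- deleted edge takes 2π away.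
    have hinner : ∀ L, (labelDarts H ρ L).Nonempty →
        ∑ p ∈ labelDarts H ρ L, (π - corner z H p.1 p.2) ≤ 2 * π := by
      intro L hL
      cases L with
      | none => exact h.turning_outer.trans (by positivity)
      | some x =>
        obtain ⟨τ, hτ, ht⟩ := h.turning_inner x hL
        unfold turning at ht
        rw [ht]
        have : (τ : ℝ) ≤ 1 := by exact_mod_cast hτ
        nlinarith [Real.pi_pos]
    have ho := h.turning_outer
    unfold turning at ho
    by_cases h1 : none = mergeLabel p q p
    · rw [if_pos h1, if_pos h1]
      have h2 : p = none ∨ q = none := by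
        rw [hpe] at h1; split_ifs at h1 with h2
        · exact Or.inr h2
        · exact Or.inl h1.symm
      by_cases h3 : p = q
      · rw [if_pos h3]
        have : p = none := by rcases h2 with h2 | h2; exacts [h2, h3.trans h2]
        rw [this]; linarith [Real.pi_pos]
      · rw [if_neg h3]
        rcases h2 with h2 | h2
        · have := hinner q hqn
          rw [h2]; linarith
        · have := hinner p hpn
          rw [h2]; linarith
    · have h2 : ¬ (none = p ∨ none = q) := by
        rintro (h2 | h2)
        · apply h1; rw [hpe]; split_ifs; exacts [rfl, h2]
        · apply h1; rw [hpe, if_pos h2.symm]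
      rw [if_neg h1, if_neg h2, if_neg h1, sub_zero]
      exact ho

/-- Every noncrossing drawing without isolated vertices has a region labelling. -/
theorem NonCrossing.exists_regionLabelling {G : SimpleGraph V} (h : NonCrossing z G)
    (hz : Function.Injective z) (hne : ∀ v, ∃ a, G.Adj v a) :
    ∃ ρ : V → V → Option (Finset V), RegionLabelling z G ρ := by
  obtain ⟨T, hGT, hT⟩ := (Set.toFinite {H : SimpleGraph V | NonCrossing z H}).exists_le_maximal h
  -- Among the labelled drawings between `G` and the maximal drawing `T`, one with the fewest edges
  -- must be `G`: any further edge could be deleted.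
  obtain ⟨H, hH, hmin⟩ := Set.exists_min_image
    {H : SimpleGraph V | G ≤ H ∧ H ≤ T ∧ ∃ ρ : V → V → Option (Finset V), RegionLabelling z H ρ}
    (fun H => Nat.card H.edgeSet) (Set.toFinite _) ⟨T, hGT, le_rfl, triangleLabel z T,
      regionLabelling_triangleLabel hT.1 hz fun H' h' hle => hT.2 h' hle⟩
  obtain ⟨hGH, hHT, ρ, hρ⟩ := hH
  by_cases hc : H ≤ G
  · rw [le_antisymm hGH hc]; exact ⟨ρ, hρ⟩
  · exfalso
    obtain ⟨v, w, hvw, hnot⟩ : ∃ v w, H.Adj v w ∧ ¬ G.Adj v w := by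
      by_contra hcon; push Not at hcon; exact hc fun v w => hcon v w
    have hle : G ≤ H.deleteEdges {s(v, w)} := by
      intro a b hab
      rw [SimpleGraph.deleteEdges_adj]
      refine ⟨hGH hab, ?_⟩
      rw [Set.mem_singleton_iff, Sym2.eq_iff]
      rintro (⟨rfl, rfl⟩ | ⟨rfl, rfl⟩)
      · exact hnot hab
      · exact hnot hab.symm
    have hHnc : NonCrossing z H := hT.1.mono hHT
    have := hmin (H.deleteEdges {s(v, w)}) ⟨hle, (SimpleGraph.deleteEdges_le _).trans hHT, _,
      hρ.deleteEdges (hHnc.dirArg_injOn_nbrs hz) hvw fun u => by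
        obtain ⟨a, ha⟩ := hne u
        exact ⟨a, mem_nbrs.2 (hle ha)⟩⟩
    refine absurd this (not_le.2 ?_)
    have hss : (H.deleteEdges {s(v, w)}).edgeSet ⊂ H.edgeSet := by
      rw [SimpleGraph.edgeSet_ssubset_edgeSet]
      refine lt_of_le_of_ne (SimpleGraph.deleteEdges_le _) fun he => ?_
      have h2 : (H.deleteEdges {s(v, w)}).Adj v w := by rw [he]; exact hvw
      rw [SimpleGraph.deleteEdges_adj] at h2
      exact h2.2 rfl
    exact Set.ncard_lt_ncard hss (Set.toFinite _)

end Deletion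

/-! ### The discrete isoperimetric inequality, by Fourier analysis on `ZMod N`. -/

section Isoperimetric

open Real

/-- Parseval's identity for the discrete Fourier transform. -/
theorem ZMod.sum_conj_dft_mul_dft {N : ℕ} [NeZero N] (f g : ZMod N → ℂ) :
    ∑ k, (starRingEnd ℂ) (ZMod.dft f k) * ZMod.dft g k =
      N * ∑ j, (starRingEnd ℂ) (f j) * g j := by
  have hconj : ∀ x : ZMod N, (starRingEnd ℂ) (ZMod.stdAddChar (-x)) = ZMod.stdAddChar x := by
    intro x
    rw [AddChar.map_neg_eq_inv, ZMod.stdAddChar_apply, ← Circle.coe_inv, ← Circle.coe_inv_eq_conj,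
      inv_inv]
  have hinv : ∀ j, ∑ k, ZMod.stdAddChar (j * k) * ZMod.dft g k = N * g j := by
    intro j
    have h1 := ZMod.invDFT_apply (ZMod.dft g) j
    rw [LinearEquiv.symm_apply_apply] at h1
    have hN : (N : ℂ) ≠ 0 := Nat.cast_ne_zero.2 (NeZero.ne N)
    rw [h1, smul_eq_mul, ← mul_assoc, mul_inv_cancel₀ hN, one_mul]
    refine Finset.sum_congr rfl fun k _ => ?_
    rw [mul_comm j k, smul_eq_mul]
  calc ∑ k, (starRingEnd ℂ) (ZMod.dft f k) * ZMod.dft g k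
      = ∑ k, ∑ j, (starRingEnd ℂ) (f j) * (ZMod.stdAddChar (j * k) * ZMod.dft g k) := by
        refine Finset.sum_congr rfl fun k _ => ?_
        rw [ZMod.dft_apply, map_sum, Finset.sum_mul]
        refine Finset.sum_congr rfl fun j _ => ?_
        rw [smul_eq_mul, map_mul, hconj]; ring
    _ = ∑ j, (starRingEnd ℂ) (f j) * (N * g j) := by
        rw [Finset.sum_comm]
        refine Finset.sum_congr rfl fun j _ => ?_
        rw [← Finset.mul_sum, hinv]
    _ = _ := by
        rw [Finset.mul_sum]
        exact Finset.sum_congr rfl fun j _ => by ring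

theorem ZMod.dft_shift {N : ℕ} [NeZero N] (f : ZMod N → ℂ) (k : ZMod N) :
    ZMod.dft (fun j => f (j + 1)) k = ZMod.stdAddChar k * ZMod.dft f k := by
  rw [ZMod.dft_apply, ZMod.dft_apply, Finset.mul_sum]
  refine Fintype.sum_equiv (Equiv.addRight 1) _ _ fun j => ?_
  simp only [Equiv.coe_addRight, smul_eq_mul]
  rw [← mul_assoc, ← AddChar.map_add_eq_mul]
  congr 2; ring

/-- With x = πk/N the character value is e^{2ix}, so the claim is 4π sin x cos x < 4N sin² x, that
is π cos x < N sin x. For cos x > 0 this follows from tan x > x ≥ π/N; otherwise the left side is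
nonpositive. -/
theorem two_pi_mul_im_stdAddChar_lt {N : ℕ} [NeZero N] {k : ZMod N} (hk : k ≠ 0) :
    2 * π * (ZMod.stdAddChar k : ℂ).im < N * ‖(ZMod.stdAddChar k : ℂ) - 1‖ ^ 2 := by
  set x : ℝ := π * k.val / N with hx
  have hN : (0 : ℝ) < N := Nat.cast_pos.2 (NeZero.pos N)
  have he : (ZMod.stdAddChar k : ℂ) = Complex.exp ((2 * x : ℝ) * Complex.I) := by
    have := ZMod.stdAddChar_coe (N := N) (k.val : ℤ)
    rw [Int.cast_natCast, ZMod.natCast_zmod_val] at this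
    rw [this, hx]; congr 1; push_cast; ring
  have hk1 : 1 ≤ k.val := Nat.one_le_iff_ne_zero.2 (by rwa [Ne, ZMod.val_eq_zero])
  have hxlow : π ≤ N * x := by
    have : (1 : ℝ) ≤ k.val := by exact_mod_cast hk1
    have h2 : N * x = π * k.val := by rw [hx]; field_simp
    rw [h2]; nlinarith [Real.pi_pos]
  have hx0 : 0 < x := by
    by_contra hc; push Not at hc; nlinarith [Real.pi_pos]
  have hxpi : x < π := by
    rw [hx, div_lt_iff₀ hN]
    have : (k.val : ℝ) < N := by exact_mod_cast ZMod.val_lt k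
    exact mul_lt_mul_of_pos_left this Real.pi_pos
  have hs := Real.sin_pos_of_pos_of_lt_pi hx0 hxpi
  have hmain : π * Real.cos x < N * Real.sin x := by
    by_cases hc : 0 < Real.cos x
    · have hx2 : x < π / 2 := by
        by_contra h2
        push Not at h2
        exact absurd (Real.cos_nonpos_of_pi_div_two_le_of_le h2 (by linarith)) (not_le.2 hc)
      have ht := Real.lt_tan hx0 hx2
      rw [Real.tan_eq_sin_div_cos, lt_div_iff₀ hc] at ht
      nlinarith
    · push Not at hc
      nlinarith [Real.pi_pos, mul_pos hN hs]
  have him : (ZMod.stdAddChar k : ℂ).im = 2 * Real.sin x * Real.cos x := by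
    rw [he, Complex.exp_ofReal_mul_I_im, Real.sin_two_mul]
  have hre : (ZMod.stdAddChar k : ℂ).re = 1 - 2 * Real.sin x ^ 2 := by
    rw [he, Complex.exp_ofReal_mul_I_re, Real.cos_two_mul, Real.cos_sq']; ring
  have hnorm : ‖(ZMod.stdAddChar k : ℂ) - 1‖ ^ 2 = 4 * Real.sin x ^ 2 := by
    rw [Complex.sq_norm, Complex.normSq_apply, Complex.sub_re, Complex.sub_im, Complex.one_re,
      Complex.one_im, hre, him]
    nlinarith [Real.sin_sq_add_cos_sq x]
  rw [him, hnorm]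
  nlinarith

theorem crossProd_eq_im (u w : ℂ) : crossProd u w = ((starRingEnd ℂ) u * w).im := by
  simp [crossProd]; ring

/-- The isoperimetric inequality for closed polygons with unit sides. -/
theorem isoperimetric_polygon {N : ℕ} [NeZero N] (ζ : ZMod N → ℂ)
    (h : ∀ j, ‖ζ (j + 1) - ζ j‖ = 1) :
    2 * π * ∑ j, crossProd (ζ j) (ζ (j + 1)) < (N : ℝ) ^ 2 := by
  have hN : (0 : ℝ) < N := Nat.cast_pos.2 (NeZero.pos N)
  set a : ZMod N → ℝ := fun k => ‖ZMod.dft ζ k‖ ^ 2 with ha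
  have ha0 : ∀ k, 0 ≤ a k := fun k => by positivity
  -- By Parseval, both the area and the total squared side length become sums over the power
  -- spectrum `a`, to be compared frequency by frequency.
  have hcross : ∑ k, (ZMod.stdAddChar k : ℂ).im * a k =
      N * ∑ j, crossProd (ζ j) (ζ (j + 1)) := by
    have h1 := congrArg Complex.im (ZMod.sum_conj_dft_mul_dft ζ (fun j => ζ (j + 1)))
    rw [← Complex.ofReal_natCast, Complex.im_ofReal_mul, Complex.im_sum, Complex.im_sum] at h1
    simp only [crossProd_eq_im]
    rw [← h1]
    refine Finset.sum_congr rfl fun k _ => ?_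
    rw [ZMod.dft_shift, mul_left_comm, ← Complex.normSq_eq_conj_mul_self,
      Complex.im_mul_ofReal, ← Complex.sq_norm]
  have hlen : ∑ k, ‖(ZMod.stdAddChar k : ℂ) - 1‖ ^ 2 * a k = (N : ℝ) ^ 2 := by
    have h1 := ZMod.sum_conj_dft_mul_dft (fun j => ζ (j + 1) - ζ j) (fun j => ζ (j + 1) - ζ j)
    have h2 : ∀ k, ZMod.dft (fun j => ζ (j + 1) - ζ j) k =
        ((ZMod.stdAddChar k : ℂ) - 1) * ZMod.dft ζ k := by
      intro k
      have : (fun j => ζ (j + 1) - ζ j) = (fun j => ζ (j + 1)) - ζ := rfl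
      rw [this, map_sub, Pi.sub_apply, ZMod.dft_shift]; ring
    simp only [← Complex.normSq_eq_conj_mul_self, ← Complex.sq_norm, h, h2, norm_mul, mul_pow] at h1
    simp only [one_pow, Complex.ofReal_one, Finset.sum_const, Finset.card_univ, ZMod.card,
      nsmul_eq_mul, mul_one] at h1
    rw [sq (N : ℝ)]
    exact_mod_cast h1
  have hle : ∀ k, 2 * π * ((ZMod.stdAddChar k : ℂ).im * a k) ≤
      N * (‖(ZMod.stdAddChar k : ℂ) - 1‖ ^ 2 * a k) := by
    intro k
    by_cases hk : k = 0
    · subst hk; simp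
    · have := mul_le_mul_of_nonneg_right (two_pi_mul_im_stdAddChar_lt hk).le (ha0 k)
      linarith
  -- The sides are nonzero, so some frequency k ≠ 0 is present, and there the comparison is strict.
  have hlt : ∃ k, 2 * π * ((ZMod.stdAddChar k : ℂ).im * a k) <
      N * (‖(ZMod.stdAddChar k : ℂ) - 1‖ ^ 2 * a k) := by
    have hpos : 0 < ∑ k, ‖(ZMod.stdAddChar k : ℂ) - 1‖ ^ 2 * a k := by rw [hlen]; positivity
    obtain ⟨k, -, hk⟩ := Finset.exists_lt_of_sum_lt (s := Finset.univ)
      (f := fun _ : ZMod N => (0 : ℝ)) (g := fun k => ‖(ZMod.stdAddChar k : ℂ) - 1‖ ^ 2 * a k)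
      (by simpa using hpos)
    have hk0 : k ≠ 0 := by rintro rfl; simp at hk
    have hak : 0 < a k := pos_of_mul_pos_right hk (by positivity)
    have := mul_lt_mul_of_pos_right (two_pi_mul_im_stdAddChar_lt hk0) hak
    exact ⟨k, by linarith⟩
  obtain ⟨k, hk⟩ := hlt
  have hsum := Finset.sum_lt_sum (fun k _ => hle k) ⟨k, Finset.mem_univ k, hk⟩
  rw [← Finset.mul_sum, ← Finset.mul_sum, hcross, hlen] at hsum
  have : N * (2 * π * ∑ j, crossProd (ζ j) (ζ (j + 1))) < N * (N : ℝ) ^ 2 := by linarith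
  exact lt_of_mul_lt_mul_left this hN.le

theorem sum_range_mul_of_periodic {c : ℕ → ℝ} {p : ℕ} (hc : ∀ i, c (p + i) = c i) (m : ℕ) :
    ∑ i ∈ Finset.range (m * p), c i = m * ∑ i ∈ Finset.range p, c i := by
  induction m with
  | zero => simp
  | succ m ih =>
    rw [Nat.succ_mul, Nat.add_comm, Finset.sum_range_add]
    simp only [hc]
    rw [ih]; push_cast; ring

/-- The isoperimetric inequality for a finite family of closed polygons with unit sides, given
by the cycles of `f`. -/
theorem isoperimetric_cycles {B : Type*} [Fintype B] [Nonempty B] {f : B → B}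
    (hf : Function.Injective f) (ζ : B → ℂ) (h : ∀ d, ‖ζ (f d) - ζ d‖ = 1) :
    2 * π * ∑ d, crossProd (ζ d) (ζ (f d)) < (Fintype.card B : ℝ) ^ 2 := by
  set c : B → ℝ := fun d => crossProd (ζ d) (ζ (f d)) with hc
  -- Every period divides `M`. Following each element for `M` steps replaces a decomposition into
  -- cycles: an orbit of period p contributes less than (M / p) p² = M p ≤ M · |B|.
  set M := (Fintype.card B).factorial with hM
  have hM0 : (0 : ℝ) < M := Nat.cast_pos.2 (Nat.factorial_pos _)
  have horb : ∀ d, 2 * π * ∑ i ∈ Finset.range M, c (f^[i] d) < M * Fintype.card B := by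
    intro d
    set p := Function.minimalPeriod f d with hp
    have hp0 : 0 < p := Function.minimalPeriod_pos_of_mem_periodicPts (hf.mem_periodicPts d)
    have hpB : p ≤ Fintype.card B := by
      have hinj : Set.InjOn (fun i => f^[i] d) (Finset.range p) := by
        intro i hi j hj hij
        rw [Finset.coe_range, Set.mem_Iio] at hi hj
        exact (Function.iterate_eq_iterate_iff_of_lt_minimalPeriod hi hj).1 hij
      have := Finset.card_le_card_of_injOn (t := Finset.univ) _ (fun _ _ => by simp) hinj
      simpa using this
    have : NeZero p := ⟨hp0.ne'⟩
    have hiso := isoperimetric_polygon (N := p) (fun j => ζ (f^[j.val] d)) (by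
      intro j
      rw [ZMod.val_add, ZMod.val_one_eq_one_mod, Nat.add_mod_mod,
        Function.iterate_mod_minimalPeriod_eq, Function.iterate_succ_apply']
      exact h _)
    have hsum : ∑ j : ZMod p, crossProd (ζ (f^[j.val] d)) (ζ (f^[(j + 1).val] d)) =
        ∑ i ∈ Finset.range p, c (f^[i] d) := by
      refine Finset.sum_bij (fun j _ => j.val) (fun j _ => Finset.mem_range.2 (ZMod.val_lt j))
        (fun i _ j _ hij => ZMod.val_injective p hij)
        (fun i hi => ⟨(i : ZMod p), Finset.mem_univ _,
          ZMod.val_cast_of_lt (Finset.mem_range.1 hi)⟩) ?_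
      intro j _
      rw [ZMod.val_add, ZMod.val_one_eq_one_mod, Nat.add_mod_mod,
        Function.iterate_mod_minimalPeriod_eq, Function.iterate_succ_apply']
    rw [hsum] at hiso
    obtain ⟨m, hm⟩ : p ∣ M := Nat.dvd_factorial hp0 hpB
    have hper := sum_range_mul_of_periodic (c := fun i => c (f^[i] d)) (p := p) (by
      intro i
      rw [Nat.add_comm, Function.iterate_add_minimalPeriod_eq]) m
    rw [mul_comm m p, ← hm] at hper
    rw [hper, hm]
    have hm0 : (0 : ℝ) < m := by
      rcases Nat.eq_zero_or_pos m with rfl | h0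
      · rw [hm] at hM0; simp at hM0
      · exact_mod_cast h0
    have hpB' : (p : ℝ) ≤ Fintype.card B := by exact_mod_cast hpB
    have hp0' : (0 : ℝ) < p := by exact_mod_cast hp0
    push_cast
    have h1 := mul_lt_mul_of_pos_left hiso hm0
    have h2 := mul_le_mul_of_nonneg_left hpB' (mul_pos hm0 hp0').le
    nlinarith
  have htot : ∑ d, ∑ i ∈ Finset.range M, c (f^[i] d) = M * ∑ d, c d := by
    rw [Finset.sum_comm]
    have : ∀ i ∈ Finset.range M, ∑ d, c (f^[i] d) = ∑ d, c d := fun i _ =>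
      (Finite.injective_iff_bijective.1 (hf.iterate i)).sum_comp c
    rw [Finset.sum_congr rfl this]; simp
  have hlt := Finset.sum_lt_sum_of_nonempty (s := Finset.univ) Finset.univ_nonempty
    (fun d _ => horb d)
  rw [← Finset.mul_sum, htot] at hlt
  simp only [Finset.sum_const, Finset.card_univ, nsmul_eq_mul] at hlt
  have : M * (2 * π * ∑ d, c d) < M * (Fintype.card B : ℝ) ^ 2 := by
    rw [sq]; linarith
  exact lt_of_mul_lt_mul_left this hM0.le

end Isoperimetric

/-! ### Charges, shares and areas of the regions. -/

section Faces

open Classical Real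

/-- The share of the charge of a region received by a corner of angle `θ`. -/
noncomputable def cornerShare (θ : ℝ) : ℝ := max 0 (min 1 (3 * θ / π - 1))

theorem cornerShare_nonneg (θ : ℝ) : 0 ≤ cornerShare θ := le_max_left _ _

theorem cornerShare_le_one (θ : ℝ) : cornerShare θ ≤ 1 :=
  max_le zero_le_one (min_le_left _ _)

theorem cornerShare_eq_zero {θ : ℝ} (h : θ ≤ π / 3) : cornerShare θ = 0 := by
  apply max_eq_left
  apply (min_le_right _ _).trans
  rw [sub_nonpos, div_le_one Real.pi_pos]; linarith

theorem cornerShare_eq_one {θ : ℝ} (h : 2 * π / 3 ≤ θ) : cornerShare θ = 1 := by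
  have : 1 ≤ 3 * θ / π - 1 := by
    rw [le_sub_iff_add_le, le_div_iff₀ Real.pi_pos]; linarith
  rw [cornerShare, min_eq_left this, max_eq_right zero_le_one]

theorem cornerShare_le {θ : ℝ} (h : π / 3 ≤ θ) : cornerShare θ ≤ 3 * θ / π - 1 := by
  have : 0 ≤ 3 * θ / π - 1 := by
    rw [le_sub_iff_add_le, le_div_iff₀ Real.pi_pos]; linarith
  exact max_le this (min_le_right _ _)

theorem le_cornerShare {θ : ℝ} (h : θ ≤ 2 * π / 3) : 3 * θ / π - 1 ≤ cornerShare θ := by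
  have : 3 * θ / π - 1 ≤ 1 := by
    rw [sub_le_iff_le_add, div_le_iff₀ Real.pi_pos]; linarith
  rw [cornerShare, min_eq_right this]
  exact le_max_right _ _

/-- This is the bound for two adjacent angles of a rhombus: if both are at least π/3, the two linear
bounds add up to exactly 1. -/
theorem cornerShare_add_le_one (θ : ℝ) : cornerShare θ + cornerShare (π - θ) ≤ 1 := by
  rcases le_total θ (π / 3) with h | h
  · rw [cornerShare_eq_zero h, zero_add]; exact cornerShare_le_one _
  rcases le_total (π - θ) (π / 3) with h' | h'
  · rw [cornerShare_eq_zero h', add_zero]; exact cornerShare_le_one _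
  have h1 := cornerShare_le h
  have h2 := cornerShare_le h'
  have : 3 * θ / π + 3 * (π - θ) / π = 3 := by field_simp; ring
  linarith

variable {V X : Type*} [Fintype V] {z : V → ℂ} {H : SimpleGraph V} {ρ : V → V → Option X}

/-- The dart preceding a dart along the boundary of the region to its left. -/
noncomputable def prevDart (z : V → ℂ) (H : SimpleGraph V) (p : V × V) : V × V :=
  (nextNbr z H p.1 p.2, p.1)

/-- With `prevDart_inj`, this makes `prevDart` a permutation of the darts of each label; its cycles
are the boundary walks of the region, run backwards. -/
theorem RegionLabelling.prevDart_mem (h : RegionLabelling z H ρ) {L : Option X} {p : V × V}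
    (hp : p ∈ labelDarts H ρ L) : prevDart z H p ∈ labelDarts H ρ L := by
  rw [mem_labelDarts] at hp ⊢
  exact ⟨(nextNbr_adj hp.1).symm, (h.next _ _ hp.1).trans hp.2⟩

theorem prevDart_inj (hinj : ∀ v, Set.InjOn (dirArg z v) (nbrs H v)) {p q : V × V}
    (hp : H.Adj p.1 p.2) (hq : H.Adj q.1 q.2) (h : prevDart z H p = prevDart z H q) : p = q := by
  obtain ⟨v, a⟩ := p
  obtain ⟨v', a'⟩ := q
  simp only [prevDart, Prod.mk.injEq] at h hp hq
  obtain ⟨h1, rfl⟩ := h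
  rw [nextDir_injOn (dirArg_mem z v) (hinj v) (mem_nbrs.2 hp) (mem_nbrs.2 hq) h1]

theorem prevDart_ne {p : V × V} (hp : H.Adj p.1 p.2) : prevDart z H p ≠ p := by
  intro h
  have := congrArg Prod.fst h
  exact (nextNbr_adj (z := z) hp).ne this.symm

theorem corner_eq_two_pi {v a : V} (h : nextNbr z H v a = a) : corner z H v a = 2 * π := by
  rw [corner_eq, h, ccwGap_self]

theorem sum_corner_labelDarts (L : Option X) :
    ∑ p ∈ labelDarts H ρ L, corner z H p.1 p.2 =
      (labelDarts H ρ L).card * π - turning z H ρ L := by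
  unfold turning
  rw [Finset.sum_sub_distrib]
  simp

/-- The scalar product of plane vectors. -/
def scalarProd (u w : ℂ) : ℝ := u.re * w.re + u.im * w.im

theorem scalarProd_eq_norm_mul_cos (u w : ℂ) :
    scalarProd u w = ‖u‖ * ‖w‖ * Real.cos (w.arg - u.arg) := by
  unfold scalarProd
  rw [Real.cos_sub]
  rw [← Complex.norm_mul_cos_arg u, ← Complex.norm_mul_sin_arg u, ← Complex.norm_mul_cos_arg w,
    ← Complex.norm_mul_sin_arg w]
  ring

theorem scalarProd_self (u : ℂ) : scalarProd u u = ‖u‖ ^ 2 := by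
  rw [Complex.sq_norm, Complex.normSq_apply, scalarProd]

theorem cos_corner {v a : V} (ha : ‖z a - z v‖ = 1) (hb : ‖z (nextNbr z H v a) - z v‖ = 1) :
    Real.cos (corner z H v a) = scalarProd (z a - z v) (z (nextNbr z H v a) - z v) := by
  rw [corner_eq, cos_ccwGap, scalarProd_eq_norm_mul_cos, ha, hb, one_mul, one_mul]; rfl

theorem sin_corner {v a : V} (ha : ‖z a - z v‖ = 1) (hb : ‖z (nextNbr z H v a) - z v‖ = 1) :
    Real.sin (corner z H v a) = crossProd (z a - z v) (z (nextNbr z H v a) - z v) := by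
  rw [corner_eq, sin_ccwGap, crossProd_eq_norm_mul_sin, ha, hb, one_mul, one_mul]; rfl

theorem corner_le_two_pi (v a : V) : corner z H v a ≤ 2 * π :=
  cornerAngle_le_two_pi (dirArg_mem z v) a

theorem eq_of_cos_eq_of_sin_eq {x y : ℝ} (hx : 0 < x) (hx' : x ≤ 2 * π) (hy : 0 < y)
    (hy' : y ≤ 2 * π) (hc : Real.cos x = Real.cos y) (hs : Real.sin x = Real.sin y) : x = y := by
  obtain ⟨k, hk⟩ := Real.Angle.angle_eq_iff_two_pi_dvd_sub.1 (Real.Angle.cos_sin_inj hc hs)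
  have hk1 : (k : ℝ) < 1 := by
    by_contra h; push Not at h; nlinarith [Real.pi_pos]
  have hk2 : (-1 : ℝ) < k := by
    by_contra h; push Not at h; nlinarith [Real.pi_pos]
  have : k = 0 := by
    have h5 : k < 1 := by exact_mod_cast hk1
    have h6 : -1 < k := by exact_mod_cast hk2
    omega
  rw [this] at hk
  simp at hk
  linarith

/-- The three corners sum to π, so none is 2π and `prevDart` has no 2-cycle; it has no fixed point
either, hence it is a 3-cycle. Unit sides then give an equilateral triangle. -/
theorem RegionLabelling.triangle (h : RegionLabelling z H ρ)
    (hinj : ∀ v, Set.InjOn (dirArg z v) (nbrs H v))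
    (hunit : ∀ v a, H.Adj v a → ‖z a - z v‖ = 1) {L : Option X}
    (hcard : (labelDarts H ρ L).card = 3) (hturn : turning z H ρ L = 2 * π) :
    (∑ p ∈ labelDarts H ρ L, cornerShare (corner z H p.1 p.2) = 0) ∧
      doubleArea z H ρ L = √3 / 2 := by
  have hsum := sum_corner_labelDarts (z := z) (H := H) (ρ := ρ) L
  rw [hcard, hturn] at hsum
  set S := labelDarts H ρ L with hS
  have hltpi : ∀ p ∈ S, corner z H p.1 p.2 < π := by
    intro p hp
    have hcS : 0 < (S.erase p).card := by rw [Finset.card_erase_of_mem hp, hcard]; norm_num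
    rw [← Finset.add_sum_erase _ _ hp] at hsum
    have := Finset.sum_pos (s := S.erase p) (f := fun p => corner z H p.1 p.2)
      (fun q _ => corner_pos _ _) (Finset.card_pos.1 hcS)
    push_cast at hsum
    linarith
  obtain ⟨⟨v, a⟩, hd0⟩ := Finset.card_pos.1 (by rw [hcard]; norm_num : 0 < S.card)
  have hd1 := h.prevDart_mem hd0
  have hd2 := h.prevDart_mem hd1
  have hd3 := h.prevDart_mem hd2
  have hA : ∀ p ∈ S, H.Adj p.1 p.2 := fun p hp => (mem_labelDarts.1 hp).1
  have n01 := prevDart_ne (z := z) (hA _ hd0)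
  have n12 := prevDart_ne (z := z) (hA _ hd1)
  have n23 := prevDart_ne (z := z) (hA _ hd2)
  have n02 : prevDart z H (prevDart z H (v, a)) ≠ (v, a) := by
    intro he
    have h1 : nextNbr z H v a = a := congrArg Prod.snd he
    have := corner_eq_two_pi h1
    have := hltpi _ hd0
    simp only at this
    linarith [Real.pi_pos]
  have n13 : prevDart z H (prevDart z H (prevDart z H (v, a))) ≠ prevDart z H (v, a) := by
    intro he
    exact n02 (prevDart_inj hinj (hA _ hd2) (hA _ hd0) he)
  have hSeq : {(v, a), prevDart z H (v, a), prevDart z H (prevDart z H (v, a))} = S := by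
    apply Finset.eq_of_subset_of_card_le
    · intro p hp
      simp only [Finset.mem_insert, Finset.mem_singleton] at hp
      rcases hp with rfl | rfl | rfl <;> assumption
    · rw [hcard, Finset.card_insert_of_notMem, Finset.card_insert_of_notMem,
        Finset.card_singleton]
      · simpa using n12.symm
      · simp only [Finset.mem_insert, Finset.mem_singleton, not_or]
        exact ⟨n01.symm, n02.symm⟩
  have he : prevDart z H (prevDart z H (prevDart z H (v, a))) = (v, a) := by
    rw [← hS, ← hSeq] at hd3
    rw [Finset.mem_insert, Finset.mem_insert, Finset.mem_singleton] at hd3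
    rcases hd3 with h3 | h3 | h3
    · exact h3
    · exact absurd h3 n13
    · exact absurd h3 n23
  have hsumS : ∀ F : V × V → ℝ, ∑ p ∈ S, F p = F (v, a) + (F (prevDart z H (v, a)) +
      F (prevDart z H (prevDart z H (v, a)))) := by
    intro F
    rw [← hSeq, Finset.sum_insert, Finset.sum_pair n12.symm]
    simp only [Finset.mem_insert, Finset.mem_singleton, not_or]
    exact ⟨n01.symm, n02.symm⟩
  clear hSeq n01 n12 n23 n02 n13
  obtain ⟨b, hb⟩ : ∃ b, nextNbr z H v a = b := ⟨_, rfl⟩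
  have hpd : ∀ x y, prevDart z H (x, y) = (nextNbr z H x y, x) := fun _ _ => rfl
  rw [hpd v a, hb] at hd1 hd2 hd3 he hsumS
  rw [hpd b v] at hd2 hd3 he hsumS
  have hc : nextNbr z H b v = a := congrArg Prod.snd he
  rw [hc] at hd2 hd3 he hsumS
  have hd : nextNbr z H a b = v := congrArg Prod.fst he
  have key : ∀ u c e, nextNbr z H u c = e → (u, c) ∈ S → H.Adj c e → corner z H u c = π / 3 := by
    intro u c e hn hm hce
    have h1 := hunit _ _ (hA _ hm)
    have h2 := hunit _ _ (nextNbr_adj (z := z) (hA _ hm))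
    have h3 := hunit _ _ hce
    simp only at h1 h2
    have hcos := cos_corner h1 h2
    rw [hn] at hcos h2
    have h4 : scalarProd (z c - z u) (z e - z u) = 1 / 2 := by
      have e1 := scalarProd_self (z c - z u)
      have e2 := scalarProd_self (z e - z u)
      have e3 := scalarProd_self (z e - z c)
      rw [h1] at e1; rw [h2] at e2; rw [h3] at e3
      simp only [scalarProd, Complex.sub_re, Complex.sub_im] at e1 e2 e3 ⊢
      linarith
    rw [h4, ← Real.cos_pi_div_three] at hcos
    exact Real.injOn_cos ⟨(corner_pos _ _).le, (hltpi _ hm).le⟩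
      ⟨by positivity, by linarith [Real.pi_pos]⟩ hcos
  have hab : H.Adj a b := hA _ hd2
  have hva : H.Adj v a := hA _ hd0
  have hbv : H.Adj b v := hA _ hd1
  have c0 := key v a b hb hd0 hab
  have c1 := key b v a hc hd1 hva
  have c2 := key a b v hd hd2 hbv
  constructor
  · rw [hsumS]
    simp only [c0, c1, c2, cornerShare_eq_zero le_rfl, add_zero]
  · unfold doubleArea
    rw [← hS, hsumS]
    have := sin_corner (hunit _ _ hva) (hunit _ _ (nextNbr_adj (z := z) hva))
    rw [c0, Real.sin_pi_div_three, hb] at this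
    rw [this]
    simp [crossProd]; ring

/-- The points `v`, `c` and `a + b - v` are all at distance 1 from both `a` and `b`, and two such
circles share at most two points. If `a + b - v = v`, then `a` and `b` are antipodal about `v`,
which forces `c = v`. -/
theorem rhombus_fourth_vertex {v a b c : ℂ} (h1 : ‖a - v‖ = 1) (h2 : ‖b - v‖ = 1)
    (h3 : ‖c - b‖ = 1) (h4 : ‖a - c‖ = 1) (hab : a ≠ b) (hcv : c ≠ v) : c = a + b - v := by
  have hfin : Module.finrank ℝ ℂ = 2 := Complex.finrank_real_complex
  have := EuclideanGeometry.eq_of_dist_eq_of_dist_eq_of_finrank_eq_two hfin (c₁ := a) (c₂ := b)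
    (p₁ := v) (p₂ := c) (p := a + b - v) (r₁ := 1) (r₂ := 1) hab hcv.symm
    (by rw [dist_comm, dist_eq_norm, h1]) (by rw [dist_comm, dist_eq_norm, h4])
    (by rw [dist_eq_norm, ← h2]; congr 1; ring) (by rw [dist_comm, dist_eq_norm, h2])
    (by rw [dist_eq_norm, h3]) (by rw [dist_eq_norm, ← h1]; congr 1; ring)
  rcases this with h5 | h5
  · exfalso
    apply hcv
    have hb : b = v + v - a := by linear_combination h5
    subst hb
    have e1 := scalarProd_self (a - v)
    have e3 := scalarProd_self (c - (v + v - a))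
    have e4 := scalarProd_self (a - c)
    rw [h1] at e1; rw [h3] at e3; rw [h4] at e4
    simp only [scalarProd, Complex.sub_re, Complex.sub_im, Complex.add_re, Complex.add_im] at e1 e3 e4
    have h6 : (c.re - v.re) * (c.re - v.re) + (c.im - v.im) * (c.im - v.im) = 0 := by linarith
    have h7 : c.re - v.re = 0 := by nlinarith [sq_nonneg (c.re - v.re), sq_nonneg (c.im - v.im)]
    have h8 : c.im - v.im = 0 := by nlinarith [sq_nonneg (c.re - v.re), sq_nonneg (c.im - v.im)]
    exact Complex.ext (by linarith) (by linarith)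
  · exact h5.symm

theorem RegionLabelling.quadrilateral (h : RegionLabelling z H ρ)
    (hz : Function.Injective z)
    (hinj : ∀ v, Set.InjOn (dirArg z v) (nbrs H v))
    (hunit : ∀ v a, H.Adj v a → ‖z a - z v‖ = 1) {L : Option X}
    (hcard : (labelDarts H ρ L).card = 4) (hturn : turning z H ρ L = 2 * π) :
    ∑ p ∈ labelDarts H ρ L, cornerShare (corner z H p.1 p.2) ≤ 2 := by
  have hsum := sum_corner_labelDarts (z := z) (H := H) (ρ := ρ) L
  rw [hcard, hturn] at hsum
  set S := labelDarts H ρ L with hS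
  have hlt : ∀ p ∈ S, corner z H p.1 p.2 < 2 * π := by
    intro p hp
    have hcS : 0 < (S.erase p).card := by rw [Finset.card_erase_of_mem hp, hcard]; norm_num
    have hs := hsum
    rw [← Finset.add_sum_erase _ _ hp] at hs
    have := Finset.sum_pos (s := S.erase p) (f := fun p => corner z H p.1 p.2)
      (fun q _ => corner_pos _ _) (Finset.card_pos.1 hcS)
    push_cast at hs
    linarith
  obtain ⟨⟨v, a⟩, hd0⟩ := Finset.card_pos.1 (by rw [hcard]; norm_num : 0 < S.card)
  have hd1 := h.prevDart_mem hd0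
  have hd2 := h.prevDart_mem hd1
  have hd3 := h.prevDart_mem hd2
  have hd4 := h.prevDart_mem hd3
  have hA : ∀ p ∈ S, H.Adj p.1 p.2 := fun p hp => (mem_labelDarts.1 hp).1
  have n01 := prevDart_ne (z := z) (hA _ hd0)
  have n12 := prevDart_ne (z := z) (hA _ hd1)
  have n23 := prevDart_ne (z := z) (hA _ hd2)
  have n34 := prevDart_ne (z := z) (hA _ hd3)
  have ntwo : ∀ p ∈ S, prevDart z H (prevDart z H p) ≠ p := by
    intro p hp he
    have h1 : nextNbr z H p.1 p.2 = p.2 := congrArg Prod.snd he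
    exact (hlt _ hp).ne (corner_eq_two_pi h1)
  have n02 := ntwo _ hd0
  have n13 := ntwo _ hd1
  have n24 := ntwo _ hd2
  -- A 3-cycle would leave the fourth dart fixed by `prevDart`, which is impossible; the count below
  -- phrases this as five distinct darts among four.
  have n03 : prevDart z H (prevDart z H (prevDart z H (v, a))) ≠ (v, a) := by
    intro he
    obtain ⟨x, hx, hx'⟩ := Finset.exists_mem_notMem_of_card_lt_card
      (s := {(v, a), prevDart z H (v, a), prevDart z H (prevDart z H (v, a))}) (t := S)
      (lt_of_le_of_lt Finset.card_le_three (by rw [hcard]; norm_num))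
    simp only [Finset.mem_insert, Finset.mem_singleton, not_or] at hx'
    have hpx := h.prevDart_mem hx
    have m0 : prevDart z H x ≠ (v, a) := fun hh =>
      hx'.2.2 (prevDart_inj hinj (hA _ hx) (hA _ hd2) (hh.trans he.symm))
    have m1 : prevDart z H x ≠ prevDart z H (v, a) := fun hh =>
      hx'.1 (prevDart_inj hinj (hA _ hx) (hA _ hd0) hh)
    have m2 : prevDart z H x ≠ prevDart z H (prevDart z H (v, a)) := fun hh =>
      hx'.2.1 (prevDart_inj hinj (hA _ hx) (hA _ hd1) hh)
    have m3 := prevDart_ne (z := z) (hA _ hx)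
    have hle : ({(v, a), prevDart z H (v, a), prevDart z H (prevDart z H (v, a)), x,
        prevDart z H x} : Finset (V × V)).card ≤ S.card := by
      apply Finset.card_le_card
      intro p hp
      simp only [Finset.mem_insert, Finset.mem_singleton] at hp
      rcases hp with rfl | rfl | rfl | rfl | rfl <;> assumption
    rw [hcard, Finset.card_insert_of_notMem, Finset.card_insert_of_notMem,
      Finset.card_insert_of_notMem, Finset.card_pair m3.symm] at hle
    · omega
    · simp only [Finset.mem_insert, Finset.mem_singleton, not_or]
      exact ⟨Ne.symm hx'.2.2, m2.symm⟩
    · simp only [Finset.mem_insert, Finset.mem_singleton, not_or]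
      exact ⟨n12.symm, Ne.symm hx'.2.1, m1.symm⟩
    · simp only [Finset.mem_insert, Finset.mem_singleton, not_or]
      exact ⟨n01.symm, n02.symm, Ne.symm hx'.1, m0.symm⟩
  have hnotin1 : (v, a) ∉ ({prevDart z H (v, a), prevDart z H (prevDart z H (v, a)),
      prevDart z H (prevDart z H (prevDart z H (v, a)))} : Finset (V × V)) := by
    simp only [Finset.mem_insert, Finset.mem_singleton, not_or]
    exact ⟨n01.symm, n02.symm, n03.symm⟩
  have hnotin2 : prevDart z H (v, a) ∉ ({prevDart z H (prevDart z H (v, a)),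
      prevDart z H (prevDart z H (prevDart z H (v, a)))} : Finset (V × V)) := by
    simp only [Finset.mem_insert, Finset.mem_singleton, not_or]
    exact ⟨n12.symm, n13.symm⟩
  have hSeq : {(v, a), prevDart z H (v, a), prevDart z H (prevDart z H (v, a)),
      prevDart z H (prevDart z H (prevDart z H (v, a)))} = S := by
    apply Finset.eq_of_subset_of_card_le
    · intro p hp
      simp only [Finset.mem_insert, Finset.mem_singleton] at hp
      rcases hp with rfl | rfl | rfl | rfl <;> assumption
    · rw [hcard, Finset.card_insert_of_notMem hnotin1, Finset.card_insert_of_notMem hnotin2,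
        Finset.card_pair n23.symm]
  have he : prevDart z H (prevDart z H (prevDart z H (prevDart z H (v, a)))) = (v, a) := by
    have n14 : prevDart z H (prevDart z H (prevDart z H (prevDart z H (v, a)))) ≠
        prevDart z H (v, a) := fun hh => n03 (prevDart_inj hinj (hA _ hd3) (hA _ hd0) hh)
    rw [← hS, ← hSeq] at hd4
    rw [Finset.mem_insert, Finset.mem_insert, Finset.mem_insert, Finset.mem_singleton] at hd4
    rcases hd4 with h4 | h4 | h4 | h4
    · exact h4
    · exact absurd h4 n14
    · exact absurd h4 n24
    · exact absurd h4 n34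
  have hsumS : ∀ F : V × V → ℝ, ∑ p ∈ S, F p = F (v, a) + (F (prevDart z H (v, a)) +
      (F (prevDart z H (prevDart z H (v, a))) +
        F (prevDart z H (prevDart z H (prevDart z H (v, a)))))) := by
    intro F
    rw [← hSeq, Finset.sum_insert hnotin1, Finset.sum_insert hnotin2, Finset.sum_pair n23.symm]
  clear hSeq hnotin1 hnotin2 n01 n12 n23 n34 n02 n13 n24 n03
  obtain ⟨b, hb⟩ : ∃ b, nextNbr z H v a = b := ⟨_, rfl⟩
  obtain ⟨c, hc⟩ : ∃ c, nextNbr z H b v = c := ⟨_, rfl⟩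
  have hpd : ∀ x y, prevDart z H (x, y) = (nextNbr z H x y, x) := fun _ _ => rfl
  rw [hpd v a, hb] at hd1 hd2 hd3 hd4 he hsumS
  rw [hpd b v, hc] at hd2 hd3 hd4 he hsumS
  rw [hpd c b] at hd3 hd4 he hsumS
  have hcb : nextNbr z H c b = a := congrArg Prod.snd he
  rw [hcb] at hd3 hd4 he hsumS
  have hac : nextNbr z H a c = v := congrArg Prod.fst he
  have hab : a ≠ b := by
    rintro rfl
    exact (hlt _ hd0).ne (corner_eq_two_pi hb)
  have hcv : c ≠ v := by
    rintro rfl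
    exact (hlt _ hd1).ne (corner_eq_two_pi hc)
  have u0 := hunit _ _ (hA _ hd0)
  have u1 := hunit _ _ (hA _ hd1)
  have u2 := hunit _ _ (hA _ hd2)
  have u3 := hunit _ _ (hA _ hd3)
  simp only at u0 u1 u2 u3
  have u0' := u0; have u1' := u1; have u2' := u2; have u3' := u3
  rw [← norm_neg, neg_sub] at u0' u1' u2' u3'
  have hpos : z c = z a + z b - z v :=
    rhombus_fourth_vertex u0 u1' u2' u3' (fun hh => hab (hz hh)) (fun hh => hcv (hz hh))
  have cos0 := cos_corner (H := H) u0 (by rw [hb]; exact u1')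
  have sin0 := sin_corner (H := H) u0 (by rw [hb]; exact u1')
  have cos1 := cos_corner (H := H) u1 (by rw [hc]; exact u2')
  have sin1 := sin_corner (H := H) u1 (by rw [hc]; exact u2')
  have cos2 := cos_corner (H := H) u2 (by rw [hcb]; exact u3')
  have sin2 := sin_corner (H := H) u2 (by rw [hcb]; exact u3')
  have cos3 := cos_corner (H := H) u3 (by rw [hac]; exact u0')
  have sin3 := sin_corner (H := H) u3 (by rw [hac]; exact u0')
  rw [hb] at cos0 sin0
  rw [hc, hpos] at cos1 sin1
  rw [hcb, hpos] at cos2 sin2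
  rw [hac, hpos] at cos3 sin3
  -- In the rhombus opposite corners are equal, and with total 2π adjacent ones sum to π.
  have e02 : corner z H v a = corner z H c b := by
    refine eq_of_cos_eq_of_sin_eq (corner_pos _ _) (corner_le_two_pi _ _) (corner_pos _ _)
      (corner_le_two_pi _ _) ?_ ?_
    · rw [cos0, cos2]; simp [scalarProd]; ring
    · rw [sin0, sin2]; simp [crossProd]; ring
  have e13 : corner z H b v = corner z H a c := by
    refine eq_of_cos_eq_of_sin_eq (corner_pos _ _) (corner_le_two_pi _ _) (corner_pos _ _)
      (corner_le_two_pi _ _) ?_ ?_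
    · rw [cos1, cos3]; simp [scalarProd]; ring
    · rw [sin1, sin3]; simp [crossProd]; ring
  rw [hsumS] at hsum ⊢
  simp only at hsum ⊢
  rw [← e02, ← e13] at hsum ⊢
  push_cast at hsum
  have e1 : corner z H b v = π - corner z H v a := by linarith
  rw [e1]
  have := cornerShare_add_le_one (corner z H v a)
  linarith

/-- A region is an equilateral triangle face. -/
def IsTriangleRegion (z : V → ℂ) (H : SimpleGraph V) (ρ : V → V → Option X) (x : X) : Prop :=
  (labelDarts H ρ (some x)).card = 3 ∧ turning z H ρ (some x) = 2 * π

/-- The charge of a region: its perimeter doubled, minus three times its turning over `π`. -/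
noncomputable def regionCharge (z : V → ℂ) (H : SimpleGraph V) (ρ : V → V → Option X)
    (L : Option X) : ℝ := 2 * (labelDarts H ρ L).card - 3 / π * turning z H ρ L

theorem regionCharge_eq_sum (L : Option X) : regionCharge z H ρ L =
    ∑ p ∈ labelDarts H ρ L, (3 * corner z H p.1 p.2 / π - 1) := by
  rw [Finset.sum_sub_distrib, ← Finset.sum_div, ← Finset.mul_sum, sum_corner_labelDarts,
    regionCharge]
  simp only [Finset.sum_const, nsmul_eq_mul, mul_one]
  field_simp
  ring

theorem sum_cornerShare_le_card (L : Option X) :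
    ∑ p ∈ labelDarts H ρ L, cornerShare (corner z H p.1 p.2) ≤ (labelDarts H ρ L).card := by
  have := Finset.sum_le_card_nsmul (labelDarts H ρ L)
    (fun p => cornerShare (corner z H p.1 p.2)) 1 (fun _ _ => cornerShare_le_one _)
  simpa using this

theorem RegionLabelling.two_mul_card_le_charge (h : RegionLabelling z H ρ) :
    2 * ((labelDarts H ρ none).card : ℝ) ≤ regionCharge z H ρ none := by
  have := h.turning_outer
  have h2 : 0 < 3 / π := by positivity
  unfold regionCharge
  nlinarith

theorem RegionLabelling.inner_cases (h : RegionLabelling z H ρ) {x : X}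
    (hx : (labelDarts H ρ (some x)).Nonempty) :
    (turning z H ρ (some x) ≤ 0) ∨
      (turning z H ρ (some x) = 2 * π ∧ 3 ≤ (labelDarts H ρ (some x)).card) := by
  obtain ⟨τ, hτ, ht⟩ := h.turning_inner x hx
  rcases hτ.lt_or_eq with h1 | h1
  · left
    have : (τ : ℝ) ≤ 0 := by exact_mod_cast (by omega : τ ≤ 0)
    rw [ht]; nlinarith [Real.pi_pos]
  · right
    have ht' : turning z H ρ (some x) = 2 * π := by rw [ht, h1]; simp
    refine ⟨ht', ?_⟩
    have hsum := sum_corner_labelDarts (z := z) (H := H) (ρ := ρ) (some x)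
    have hpos := Finset.sum_pos (f := fun p : V × V => corner z H p.1 p.2)
      (fun q _ => corner_pos _ _) hx
    rw [hsum, ht'] at hpos
    have : (2 : ℝ) < (labelDarts H ρ (some x)).card := by
      by_contra hc; push Not at hc; nlinarith [Real.pi_pos]
    have : 2 < (labelDarts H ρ (some x)).card := by exact_mod_cast this
    omega

/-- Nonpositive turning, or k ≥ 6, leaves a charge of at least k, one unit per corner. Otherwise the
charge is 2k - 6: the shares vanish in a triangle and total at most 2 in a rhombus. In a pentagon
either one corner gets nothing and the others at most 4, or all angles exceed π/3 and the linear
bounds add up to the charge. -/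
theorem RegionLabelling.sum_cornerShare_le (h : RegionLabelling z H ρ)
    (hz : Function.Injective z)
    (hinj : ∀ v, Set.InjOn (dirArg z v) (nbrs H v))
    (hunit : ∀ v a, H.Adj v a → ‖z a - z v‖ = 1) (x : X) :
    ∑ p ∈ labelDarts H ρ (some x), cornerShare (corner z H p.1 p.2) ≤
      regionCharge z H ρ (some x) := by
  rcases (labelDarts H ρ (some x)).eq_empty_or_nonempty with he | hx
  · simp [regionCharge, turning, he]
  have hle := sum_cornerShare_le_card (z := z) (H := H) (ρ := ρ) (some x)
  rcases h.inner_cases hx with ht | ⟨ht, hk⟩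
  · have h2 : 0 < 3 / π := by positivity
    unfold regionCharge
    nlinarith [Nat.cast_nonneg (α := ℝ) (labelDarts H ρ (some x)).card]
  have hch : regionCharge z H ρ (some x) = 2 * (labelDarts H ρ (some x)).card - 6 := by
    rw [regionCharge, ht]; field_simp; ring
  rcases lt_or_ge 5 (labelDarts H ρ (some x)).card with h6 | h6
  · have : (6 : ℝ) ≤ (labelDarts H ρ (some x)).card := by exact_mod_cast h6
    linarith
  have hcases : (labelDarts H ρ (some x)).card = 3 ∨ (labelDarts H ρ (some x)).card = 4 ∨
      (labelDarts H ρ (some x)).card = 5 := by omega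
  rcases hcases with hk | hk | hk
  · rw [(h.triangle hinj hunit hk ht).1, hch, hk]; norm_num
  · rw [hch, hk]
    have := h.quadrilateral hz hinj hunit hk ht
    push_cast; linarith
  · by_cases hs : ∃ p ∈ labelDarts H ρ (some x), corner z H p.1 p.2 ≤ π / 3
    · obtain ⟨p, hp, hs⟩ := hs
      rw [← Finset.add_sum_erase _ _ hp, cornerShare_eq_zero hs, hch, hk]
      have := Finset.sum_le_card_nsmul ((labelDarts H ρ (some x)).erase p)
        (fun p => cornerShare (corner z H p.1 p.2)) 1 (fun _ _ => cornerShare_le_one _)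
      rw [Finset.card_erase_of_mem hp, hk] at this
      norm_num at this ⊢
      exact this
    · push Not at hs
      rw [regionCharge_eq_sum]
      exact Finset.sum_le_sum fun p hp => cornerShare_le (hs p hp).le

theorem RegionLabelling.card_le_charge (h : RegionLabelling z H ρ) (x : X) :
    ((labelDarts H ρ (some x)).card : ℝ) ≤ 2 * regionCharge z H ρ (some x) +
      if IsTriangleRegion z H ρ x then 3 else 0 := by
  rcases (labelDarts H ρ (some x)).eq_empty_or_nonempty with he | hx
  · simp [regionCharge, turning, IsTriangleRegion, he]
  have hk0 := Nat.cast_nonneg (α := ℝ) (labelDarts H ρ (some x)).card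
  rcases h.inner_cases hx with ht | ⟨ht, hk⟩
  · have h2 : 0 < 3 / π := by positivity
    have h3 : (0 : ℝ) ≤ if IsTriangleRegion z H ρ x then 3 else 0 := by split_ifs <;> norm_num
    unfold regionCharge
    nlinarith
  have hch : regionCharge z H ρ (some x) = 2 * (labelDarts H ρ (some x)).card - 6 := by
    rw [regionCharge, ht]; field_simp; ring
  rw [hch]
  split_ifs with hT
  · rw [hT.1]; norm_num
  · have h4 : 4 ≤ (labelDarts H ρ (some x)).card := by
      rcases hk.lt_or_eq with h5 | h5
      · exact h5
      · exact absurd ⟨h5.symm, ht⟩ hT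
    have : (4 : ℝ) ≤ (labelDarts H ρ (some x)).card := by exact_mod_cast h4
    linarith

theorem RegionLabelling.triangle_le_area (h : RegionLabelling z H ρ)
    (hinj : ∀ v, Set.InjOn (dirArg z v) (nbrs H v))
    (hunit : ∀ v a, H.Adj v a → ‖z a - z v‖ = 1) (x : X) :
    (if IsTriangleRegion z H ρ x then √3 / 2 else 0) ≤ doubleArea z H ρ (some x) := by
  split_ifs with hT
  · exact (h.triangle hinj hunit hT.1 hT.2).2.ge
  · rcases (labelDarts H ρ (some x)).eq_empty_or_nonempty with he | hx
    · simp [doubleArea, he]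
    · exact (h.area_inner x hx).le

/-- `prevDart` runs the boundary backwards, hence the minus sign. It is applied to the outer region,
whose own signed area is negative or zero. -/
theorem RegionLabelling.isoperimetric (h : RegionLabelling z H ρ)
    (hinj : ∀ v, Set.InjOn (dirArg z v) (nbrs H v))
    (hunit : ∀ v a, H.Adj v a → ‖z a - z v‖ = 1) {L : Option X}
    (hne : (labelDarts H ρ L).Nonempty) :
    2 * π * -doubleArea z H ρ L < ((labelDarts H ρ L).card : ℝ) ^ 2 := by
  set S := labelDarts H ρ L with hS
  have hA : ∀ p ∈ S, H.Adj p.1 p.2 := fun p hp => (mem_labelDarts.1 hp).1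
  let f : S → S := fun p => ⟨prevDart z H p, h.prevDart_mem p.2⟩
  have hf : Function.Injective f := by
    intro p q hpq
    exact Subtype.ext (prevDart_inj hinj (hA _ p.2) (hA _ q.2) (congrArg Subtype.val hpq))
  have : Nonempty S := hne.to_subtype
  have hiso := isoperimetric_cycles hf (fun p => z p.1.1) (fun p =>
    hunit _ _ (nextNbr_adj (hA _ p.2)))
  rw [Fintype.card_coe] at hiso
  have harea : ∑ p : S, crossProd (z p.1.1) (z (f p).1.1) = -doubleArea z H ρ L := by
    have h1 : ∀ p : S, crossProd (z p.1.1) (z (f p).1.1) =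
        (fun q : S => -crossProd (z q.1.1) (z q.1.2)) (f p) := by
      intro p
      have : (f p).1.2 = p.1.1 := rfl
      simp only [this]
      simp [crossProd]; ring
    rw [Finset.sum_congr rfl fun p _ => h1 p,
      (Finite.injective_iff_bijective.1 hf).sum_comp (fun q : S => -crossProd (z q.1.1) (z q.1.2)),
      Finset.sum_neg_distrib]
    congr 1
    exact Finset.sum_coe_sort S (fun q => crossProd (z q.1) (z q.2))
  rw [harea] at hiso
  exact hiso

end Faces

/-! ### Discharging and the numerical conclusion. -/

section Counting

open Classical Real

/-- The weight `4, 3, 2, 1` of a vertex of degree `1, 2, 3, 4`. -/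
def degreeWeight (d : ℕ) : ℕ := (if d = 1 then 4 else 0) + (if d = 2 then 3 else 0) +
  (if d = 3 then 2 else 0) + (if d = 4 then 1 else 0)

theorem five_le_add_degreeWeight {d : ℕ} (h : d ≠ 0) : 5 ≤ d + degreeWeight d := by
  rcases Nat.lt_or_ge d 5 with h5 | h5
  · interval_cases d <;> simp_all [degreeWeight]
  · omega

theorem degreeWeight_of_le_five {d : ℕ} (h : d ≠ 0) (h5 : d ≤ 5) : d + degreeWeight d = 5 := by
  interval_cases d <;> simp_all [degreeWeight]

variable {V X : Type*} [Fintype V] {z : V → ℂ} {H : SimpleGraph V} {ρ : V → V → Option X}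

/-- The charge collected by a vertex is enough to cover its deficit, up to its weight. -/
theorem vertex_charge (hinj : ∀ v, Set.InjOn (dirArg z v) (nbrs H v)) {v : V}
    (hv : (nbrs H v).Nonempty) :
    6 - ((nbrs H v).card : ℝ) - degreeWeight (nbrs H v).card ≤
      ∑ a ∈ nbrs H v, cornerShare (corner z H v a) := by
  have hd := Finset.card_pos.2 hv
  have h0 : 0 ≤ ∑ a ∈ nbrs H v, cornerShare (corner z H v a) :=
    Finset.sum_nonneg fun _ _ => cornerShare_nonneg _
  have h5 : (5 : ℝ) ≤ (nbrs H v).card + degreeWeight (nbrs H v).card := by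
    exact_mod_cast five_le_add_degreeWeight hd.ne'
  rcases lt_or_ge 5 (nbrs H v).card with h6 | h6
  · have : (6 : ℝ) ≤ (nbrs H v).card := by exact_mod_cast h6
    have h7 := Nat.cast_nonneg (α := ℝ) (degreeWeight (nbrs H v).card)
    linarith
  suffices 1 ≤ ∑ a ∈ nbrs H v, cornerShare (corner z H v a) by linarith
  -- For d ≤ 5 one unit is enough. A single corner of at least 2π/3 supplies it; otherwise all
  -- shares dominate 3θ/π - 1, and these sum to 6 - d ≥ 1.
  by_cases hs : ∃ a ∈ nbrs H v, 2 * π / 3 ≤ corner z H v a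
  · obtain ⟨a, ha, hs⟩ := hs
    rw [← cornerShare_eq_one hs]
    exact Finset.single_le_sum (f := fun a => cornerShare (corner z H v a))
      (fun _ _ => cornerShare_nonneg _) ha
  · push Not at hs
    have h1 := Finset.sum_le_sum fun a ha => le_cornerShare (hs a ha).le
    refine le_trans ?_ h1
    rw [Finset.sum_sub_distrib, ← Finset.sum_div, ← Finset.mul_sum]
    have h2 : ∑ a ∈ nbrs H v, corner z H v a = 2 * π :=
      sum_cornerAngle (dirArg_mem z v) (hinj v) hv
    have h3 : ((nbrs H v).card : ℝ) ≤ 5 := by exact_mod_cast h6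
    rw [h2]
    simp only [Finset.sum_const, nsmul_eq_mul, mul_one]
    have : 3 * (2 * π) / π = 6 := by field_simp; norm_num
    linarith

theorem sum_labels [Fintype X] (ρ : V → V → Option X) (F : V × V → ℝ) :
    ∑ L, ∑ p ∈ labelDarts H ρ L, F p = ∑ v, ∑ a ∈ nbrs H v, F (v, a) := by
  have h1 : ∀ L, labelDarts H ρ L = (Finset.univ.filter fun p : V × V => H.Adj p.1 p.2).filter
      fun p => ρ p.1 p.2 = L := by
    intro L; ext p; simp
  simp only [h1]
  rw [Finset.sum_fiberwise, Finset.sum_filter, Fintype.sum_prod_type]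
  refine Finset.sum_congr rfl fun v _ => ?_
  rw [nbrs, Finset.sum_filter]

/-- Both sides sum 3θ/π - 1 over all corners, grouped by region and by vertex; the angles at a
vertex total 2π. -/
theorem sum_regionCharge [Fintype X] (hinj : ∀ v, Set.InjOn (dirArg z v) (nbrs H v))
    (hne : ∀ v, (nbrs H v).Nonempty) (ρ : V → V → Option X) :
    ∑ L, regionCharge z H ρ L = ∑ v, (6 - ((nbrs H v).card : ℝ)) := by
  simp only [regionCharge_eq_sum]
  rw [sum_labels ρ (fun p => 3 * corner z H p.1 p.2 / π - 1)]
  refine Finset.sum_congr rfl fun v _ => ?_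
  rw [Finset.sum_sub_distrib, ← Finset.sum_div, ← Finset.mul_sum]
  have h2 : ∑ a ∈ nbrs H v, corner z H v a = 2 * π :=
    sum_cornerAngle (dirArg_mem z v) (hinj v) (hne v)
  rw [h2]
  simp only [Finset.sum_const, nsmul_eq_mul, mul_one]
  have : 3 * (2 * π) / π = 6 := by field_simp; norm_num
  rw [this]

theorem sum_doubleArea [Fintype X] (ρ : V → V → Option X) : ∑ L, doubleArea z H ρ L = 0 := by
  unfold doubleArea
  rw [sum_labels ρ (fun p => crossProd (z p.1) (z p.2))]
  simp only [nbrs, Finset.sum_filter]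
  have h : ∑ v, ∑ a, (if H.Adj v a then crossProd (z v) (z a) else 0) =
      -∑ v, ∑ a, (if H.Adj v a then crossProd (z v) (z a) else 0) := by
    conv_lhs => rw [Finset.sum_comm]
    rw [← Finset.sum_neg_distrib]
    refine Finset.sum_congr rfl fun v _ => ?_
    rw [← Finset.sum_neg_distrib]
    refine Finset.sum_congr rfl fun a _ => ?_
    rw [H.adj_comm]
    split_ifs
    · simp [crossProd]; ring
    · simp
  linarith

theorem sum_card_labelDarts [Fintype X] (ρ : V → V → Option X) :
    ∑ L, ((labelDarts H ρ L).card : ℝ) = ∑ v, ((nbrs H v).card : ℝ) := by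
  have := sum_labels (H := H) ρ (fun _ => 1)
  simpa using this

section Bounds

variable [Fintype X]

/-- The number of triangle regions. -/
noncomputable def numTriangles (z : V → ℂ) (H : SimpleGraph V) (ρ : V → V → Option X) : ℕ :=
  (Finset.univ.filter fun x => IsTriangleRegion z H ρ x).card

/-- The vertices receive at most the total inner charge plus b, while the outer charge is at least
2b. The surplus b has to be covered by the weights. -/
theorem RegionLabelling.outer_le_weight (h : RegionLabelling z H ρ)
    (hz : Function.Injective z)
    (hinj : ∀ v, Set.InjOn (dirArg z v) (nbrs H v))
    (hunit : ∀ v a, H.Adj v a → ‖z a - z v‖ = 1) (hne : ∀ v, (nbrs H v).Nonempty) :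
    (labelDarts H ρ none).card ≤ ∑ v, degreeWeight (nbrs H v).card := by
  have h1 := Finset.sum_le_sum fun v (_ : v ∈ Finset.univ) => vertex_charge hinj (hne v)
  rw [← sum_labels ρ (fun p => cornerShare (corner z H p.1 p.2)), Fintype.sum_option,
    Finset.sum_sub_distrib, ← sum_regionCharge hinj hne ρ, Fintype.sum_option] at h1
  have h2 := Finset.sum_le_sum fun x (_ : x ∈ Finset.univ) => h.sum_cornerShare_le hz hinj hunit x
  have h3 := sum_cornerShare_le_card (z := z) (H := H) (ρ := ρ) none
  have h4 := h.two_mul_card_le_charge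
  have h5 : ((labelDarts H ρ none).card : ℝ) ≤ ∑ v, (degreeWeight (nbrs H v).card : ℝ) := by
    linarith
  exact_mod_cast h5

/-- Let D be the sum of the degrees. Summing `card_le_charge` over the inner regions gives D - b ≤
2(6n - D - 2b) + 3t, that is D + b ≤ 4n + t. Combine this with D + W ≥ 5n. -/
theorem RegionLabelling.le_numTriangles (h : RegionLabelling z H ρ)
    (hinj : ∀ v, Set.InjOn (dirArg z v) (nbrs H v)) (hne : ∀ v, (nbrs H v).Nonempty) :
    Fintype.card V + (labelDarts H ρ none).card ≤
      numTriangles z H ρ + ∑ v, degreeWeight (nbrs H v).card := by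
  have h1 := Finset.sum_le_sum fun x (_ : x ∈ Finset.univ) => h.card_le_charge x
  rw [Finset.sum_add_distrib, ← Finset.mul_sum, ← Finset.sum_filter, Finset.sum_const,
    nsmul_eq_mul] at h1
  have h2 := sum_card_labelDarts (H := H) ρ
  have h3 := sum_regionCharge hinj hne ρ
  rw [Fintype.sum_option] at h2 h3
  rw [Finset.sum_sub_distrib] at h3
  have h4 := h.two_mul_card_le_charge
  have h5 : ∑ v : V, (5 : ℝ) ≤
      ∑ v, (((nbrs H v).card : ℝ) + (degreeWeight (nbrs H v).card : ℝ)) := by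
    refine Finset.sum_le_sum fun v _ => ?_
    exact_mod_cast five_le_add_degreeWeight (Finset.card_pos.2 (hne v)).ne'
  rw [Finset.sum_add_distrib] at h5
  simp only [Finset.sum_const, Finset.card_univ, nsmul_eq_mul] at h3 h5
  have h6 : (Fintype.card V : ℝ) + (labelDarts H ρ none).card ≤
      numTriangles z H ρ + ∑ v, (degreeWeight (nbrs H v).card : ℝ) := by
    unfold numTriangles
    linarith
  exact_mod_cast h6

/-- All signed areas cancel, since the two darts of an edge contribute opposite terms; so the outer
region carries minus the total inner area. -/
theorem RegionLabelling.triangles_le_outer_area (h : RegionLabelling z H ρ)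
    (hinj : ∀ v, Set.InjOn (dirArg z v) (nbrs H v))
    (hunit : ∀ v a, H.Adj v a → ‖z a - z v‖ = 1) :
    numTriangles z H ρ * (√3 / 2) ≤ -doubleArea z H ρ none := by
  have h1 := Finset.sum_le_sum fun x (_ : x ∈ Finset.univ) => h.triangle_le_area hinj hunit x
  rw [← Finset.sum_filter, Finset.sum_const, nsmul_eq_mul] at h1
  have h2 := sum_doubleArea (z := z) (H := H) ρ
  rw [Fintype.sum_option] at h2
  unfold numTriangles
  linarith

theorem RegionLabelling.outer_nonempty (h : RegionLabelling z H ρ) [Nonempty V]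
    (hne : ∀ v, (nbrs H v).Nonempty) : (labelDarts H ρ none).Nonempty := by
  by_contra hcon
  rw [Finset.not_nonempty_iff_eq_empty] at hcon
  obtain ⟨v⟩ := ‹Nonempty V›
  obtain ⟨a, ha⟩ := hne v
  rw [mem_nbrs] at ha
  have h2 := sum_doubleArea (z := z) (H := H) ρ
  rw [Fintype.sum_option] at h2
  have h0 : doubleArea z H ρ none = 0 := by rw [doubleArea, hcon, Finset.sum_empty]
  obtain ⟨x, hx⟩ : ∃ x, ρ v a = some x := by
    rw [← Option.ne_none_iff_exists']
    intro hn
    have : (v, a) ∈ labelDarts H ρ none := mem_labelDarts.2 ⟨ha, hn⟩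
    rw [hcon] at this
    simp at this
  have hpos : 0 < ∑ x, doubleArea z H ρ (some x) := by
    refine Finset.sum_pos' (fun y _ => ?_) ⟨x, Finset.mem_univ _,
      h.area_inner x ⟨(v, a), mem_labelDarts.2 ⟨ha, hx⟩⟩⟩
    rcases (labelDarts H ρ (some y)).eq_empty_or_nonempty with he | hy
    · rw [doubleArea, he, Finset.sum_empty]
    · exact (h.area_inner y hy).le
  linarith

end Bounds

theorem sq_gt_of_bounds {b W t n : ℕ} {c : ℝ} (hc : 4 ≤ c) (hc6 : c ≤ 6) (hb : 0 < b)
    (hbW : b ≤ W) (hct : c * t < (b : ℝ) ^ 2) (hnt : n + b ≤ t + W) (hn : 2 ≤ n)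
    (hn3 : n ≤ 3 → 3 * n ≤ W) : c * n < (W : ℝ) ^ 2 := by
  have hnt' : (n : ℝ) + b ≤ t + W := by exact_mod_cast hnt
  rcases hbW.lt_or_eq with hlt | rfl
  · rcases lt_or_ge (W + b) 6 with h6 | h6
    -- Here b ≤ 2, so t = 0 because c ≥ 4. Then n ≤ W - b ≤ 3, and `hn3` gives W ≥ 3n ≥ 6, too
    -- large.
    · exfalso
      have ht : t = 0 := by
        by_contra h0
        have h1 : (1 : ℝ) ≤ t := by exact_mod_cast Nat.one_le_iff_ne_zero.2 h0
        have h2 : (b : ℝ) ≤ 2 := by exact_mod_cast (by omega : b ≤ 2)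
        have h3 : (0 : ℝ) < b := by exact_mod_cast hb
        nlinarith
      have := hn3 (by omega)
      omega
    · have h6' : (6 : ℝ) ≤ W + b := by exact_mod_cast h6
      have hlt' : (b : ℝ) < W := by exact_mod_cast hlt
      nlinarith
  · nlinarith

end Counting

/-! ### Passage from matchstick graphs to drawings in ℂ, and conclusion. -/

section Main

open Real

open Classical in
theorem MatchstickGraph.sum_degreeWeight {V : Type*} [Fintype V] (G : MatchstickGraph V)
    [DecidableRel G.graph.Adj] :
    4 * G.numDegree 1 + 3 * G.numDegree 2 + 2 * G.numDegree 3 + G.numDegree 4 =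
      ∑ v, degreeWeight (G.graph.degree v) := by
  unfold MatchstickGraph.numDegree degreeWeight
  simp only [Finset.sum_add_distrib, ← Finset.sum_filter, Finset.sum_const, smul_eq_mul]
  ring

/-- The positions of the vertices as complex numbers. -/
noncomputable def MatchstickGraph.toComplex {V : Type*} (G : MatchstickGraph V) (v : V) : ℂ :=
  ⟨G.pos v 0, G.pos v 1⟩

theorem MatchstickGraph.toComplex_injective {V : Type*} (G : MatchstickGraph V) :
    Function.Injective G.toComplex := by
  intro v w h
  apply G.pos_injective
  have h0 := congrArg Complex.re h
  have h1 := congrArg Complex.im h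
  ext i
  fin_cases i
  · exact h0
  · exact h1

theorem MatchstickGraph.norm_toComplex_sub {V : Type*} (G : MatchstickGraph V) {v w : V}
    (h : G.graph.Adj v w) : ‖G.toComplex w - G.toComplex v‖ = 1 := by
  have h1 := G.unit_length v w h
  rw [EuclideanSpace.dist_eq, Fin.sum_univ_two] at h1
  rw [← norm_neg, neg_sub, Complex.norm_eq_sqrt_sq_add_sq, ← h1, Real.dist_eq, Real.dist_eq, sq_abs, sq_abs]
  rfl

theorem MatchstickGraph.toComplex_mem_openSegment {p q r : EuclideanSpace ℝ (Fin 2)}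
    (h : (⟨r 0, r 1⟩ : ℂ) ∈ openSegment ℝ (⟨p 0, p 1⟩ : ℂ) ⟨q 0, q 1⟩) :
    r ∈ openSegment ℝ p q := by
  obtain ⟨α, β, hα, hβ, hαβ, h⟩ := h
  refine ⟨α, β, hα, hβ, hαβ, ?_⟩
  have h0 := congrArg Complex.re h
  have h1 := congrArg Complex.im h
  simp at h0 h1
  ext i
  fin_cases i
  · simpa using h0
  · simpa using h1

theorem MatchstickGraph.nonCrossing {V : Type*} (G : MatchstickGraph V) :
    NonCrossing G.toComplex G.graph := by
  constructor
  · intro u v w huv h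
    exact G.vertex_not_mem_edge u v w huv (toComplex_mem_openSegment h)
  · intro u v x y huv hxy hne
    rw [Set.disjoint_left]
    intro m h1 h2
    have hm : (⟨(!₂[m.re, m.im] : EuclideanSpace ℝ (Fin 2)) 0,
      (!₂[m.re, m.im] : EuclideanSpace ℝ (Fin 2)) 1⟩ : ℂ) = m := by
      apply Complex.ext <;> simp
    rw [← hm] at h1 h2
    exact Set.disjoint_left.1 (G.edges_disjoint u v x y huv hxy hne)
      (toComplex_mem_openSegment h1) (toComplex_mem_openSegment h2)

end Main

theorem theorem1 {V : Type*} [Fintype V] [Nonempty V] (G : MatchstickGraph V)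
    [DecidableRel G.graph.Adj] (hG : ∀ v : V, G.graph.degree v ≠ 0) :
    (4 * G.numDegree 1 + 3 * G.numDegree 2 + 2 * G.numDegree 3 + G.numDegree 4 : ℝ) >
      Real.sqrt (Real.pi * Real.sqrt 3 * (Fintype.card V : ℝ)) := by
  have hcard : ∀ v, (nbrs G.graph v).card = G.graph.degree v := by
    intro v
    rw [← SimpleGraph.card_neighborFinset_eq_degree]
    congr 1; ext; simp
  have hne : ∀ v, (nbrs G.graph v).Nonempty := fun v => by
    rw [← Finset.card_pos, hcard]; exact Nat.pos_of_ne_zero (hG v)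
  have hz := G.toComplex_injective
  have hinj := G.nonCrossing.dirArg_injOn_nbrs hz
  have hunit : ∀ v a, G.graph.Adj v a → ‖G.toComplex a - G.toComplex v‖ = 1 :=
    fun v a h => G.norm_toComplex_sub h
  obtain ⟨ρ, hρ⟩ := G.nonCrossing.exists_regionLabelling hz fun v => by
    obtain ⟨a, ha⟩ := hne v
    exact ⟨a, mem_nbrs.1 ha⟩
  have hout := hρ.outer_nonempty hne
  have hb := hρ.outer_le_weight hz hinj hunit hne
  have ht := hρ.le_numTriangles hinj hne
  have harea := hρ.triangles_le_outer_area hinj hunit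
  have hiso := hρ.isoperimetric hinj hunit hout
  simp only [hcard] at hb ht
  rw [← G.sum_degreeWeight] at hb ht
  have hdeg : ∀ v, G.graph.degree v < Fintype.card V := fun v => G.graph.degree_lt_card_verts v
  have hn : 2 ≤ Fintype.card V := by
    obtain ⟨v⟩ := ‹Nonempty V›
    have := hdeg v
    have := hG v
    omega
  -- With at most three vertices all degrees are at most 2, so each weight 5 - d is at least 3.
  have hn3 : Fintype.card V ≤ 3 → 3 * Fintype.card V ≤
      4 * G.numDegree 1 + 3 * G.numDegree 2 + 2 * G.numDegree 3 + G.numDegree 4 := by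
    intro h3
    rw [G.sum_degreeWeight, mul_comm, ← smul_eq_mul, ← Finset.card_univ, ← Finset.sum_const]
    refine Finset.sum_le_sum fun v _ => ?_
    have h1 := hdeg v
    have h2 := degreeWeight_of_le_five (hG v) (by omega)
    omega
  have h3lo : (1.7 : ℝ) ≤ √3 := Real.le_sqrt_of_sq_le (by norm_num)
  have h3hi : √3 ≤ (1.8 : ℝ) := Real.sqrt_le_iff.2 (by norm_num)
  have hpilo := Real.pi_gt_three
  have hpihi := Real.pi_lt_d2
  -- The area hypothesis is `harea` multiplied by 2π and chained with `hiso`: π√3 · t ≤ 2π · (outer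
  -- double area) < b².
  have hfinal := sq_gt_of_bounds (c := Real.pi * √3) (by nlinarith) (by nlinarith)
    (Finset.card_pos.2 hout) hb (by nlinarith) ht hn hn3
  push_cast at hfinal
  rw [gt_iff_lt, Real.sqrt_lt' ?_]
  · exact hfinal
  · have h1 : 0 < 4 * G.numDegree 1 + 3 * G.numDegree 2 + 2 * G.numDegree 3 + G.numDegree 4 :=
      lt_of_lt_of_le (Finset.card_pos.2 hout) hb
    exact_mod_cast h1
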